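/- **Conventions.** A tensor $\mathcal A\in\mathbb C^{m\times n\times p}$ ($p\ge 1$) has frontal slices $A^{(1)},\dots,A^{(p)}$; $\mathrm{bcirc}(\mathcal A)\in\mathbb C^{mp\times np}$ is the block circulant matrix with first block column $A^{(1)},\dots,A^{(p)}$; the T-product is $\mathcal A*\mathcal B=\mathrm{fold}(\mathrm{bcirc}(\mathcal A)\,\mathrm{unfold}(\mathcal B))$; $\mathcal A^H$ is obtained by conjugate transposing all slices and reversing the order of slices $2,\dots,p$; $\mathcal A^\dagger=\mathrm{bcirc}^{-1}(\mathrm{bcirc}(\mathcal A)^\dagger)$ is the Moore–Penrose inverse. With $F_p=p^{-1/2}(e^{-2\pi\mathbf i ab/p})_{0\le a,b<p}$ and $m\times n$ matrices $D_1,\dots,D_p$, write $\Phi(D_1,\dots,D_p)=\mathrm{bcirc}^{-1}\big((F_p\otimes I_m)\,\mathrm{diag}(D_1,\dots,D_p)\,(F_p^H\otimes I_n)\big)$. Let $\mathcal A\in\mathbb C^{m\times n\times p}$ (for instance a real tensor) have the T-SVD $\mathcal A=\mathcal U*\mathcal S*\mathcal V^H$, that is, $\mathcal U=\Phi(U_1,\dots,U_p)$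 and $\mathcal V^H=\Phi(V_1^H,\dots,V_p^H)$ with $\mathcal U,\mathcal V$ unitary, and $\mathcal S=\Phi(\Sigma_1,\dots,\Sigma_p)$ F-diagonal, where each $\Sigma_i\in\mathbb R^{m\times n}$ is diagonal with non-negative diagonal entries $c^{(i)}_1\ge c^{(i)}_2\ge\cdots$. For $f:\mathbb C\to\mathbb C$ put $f^\Diamond(\mathcal A)=\mathcal U*\Phi(\tilde f(\Sigma_1),\dots,\tilde f(\Sigma_p))*\mathcal V^H$, where $\tilde f(\Sigma_i)$ replaces each non-zero diagonal entry $c$ of $\Sigma_i$ by $f(c)$ and keeps the zeros; part (2) below holds for $f^\Diamond(\mathcal A)$ computed from any T-SVD of $\mathcal A$. Let $r=\max_i\operatorname{rank}\Sigma_i$ be the tubal rank, let $(U_i)_r=(u^{(i)}_1,\dots,u^{(i)}_r)$ and $(V_i)_r=(v^{(i)}_1,\dots,v^{(i)}_r)$ be the first $r$ columns of $U_i$ and $V_i$, and let $\mathcal U_{(r)}=\Phi((U_1)_r,\dots,(U_p)_r)$, $\mathcal V_{(r)}^H=\Phi((V_1)_r^H,\dots,(V_p)_r^H)$ be the factors of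 the T-CSVD $\mathcal A=\mathcal U_{(r)}*\mathcal S_{(r)}*\mathcal V_{(r)}^H$. Put $\mathcal E=\mathcal U_{(r)}*\mathcal V_{(r)}^H$, and let $\mathcal E^{(i)}_j=\Phi(0,\dots,0,u^{(i)}_jv^{(i)H}_j,0,\dots,0)$ with the non-zero block in position $i$, for $1\le i\le p$, $1\le j\le r$. Let $\{\gamma_k^{(l)}\}$ be the set of distinct values of the $c^{(i)}_j$ with $1\le i\le p$, $1\le j\le r$ (this includes $0$ if one of these is $0$), and put $$\bar{\mathcal E}_k^{(l)}=\sum_{c^{(i)}_j=\gamma_k^{(l)}}\mathcal E^{(i)}_j .$$ For each $\gamma_k^{(l)}$ let $\Gamma_k^{(l)}$ be a simple closed positively oriented piecewise $C^1$ contour such that $\gamma_k^{(l)}$ is inside $\Gamma_k^{(l)}$ and no other $\gamma_{k'}^{(l')}$ is on or inside $\Gamma_k^{(l)}$. Integrals of tensors are taken entrywise, and $\int_\Gamma$ denotes $\sum_{k,l}\int_{\Gamma_k^{(l)}}$. **Theorem (Cauchy integral formula).** (1) For all $k,l$, $$\bar{\mathcal E}_k^{(l)}=\mathcal E*\Big(\frac1{2\pi\mathbf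 i}\int_{\Gamma_k^{(l)}}(z\mathcal E-\mathcal A)^\dagger\,dz\Big)*\mathcal E .$$ (2) If $f:\mathbb C\to\mathbb C$ is analytic on and inside every $\Gamma_k^{(l)}$, and $f(0)=0$ in case some $c^{(i)}_j$ with $j\le r$ is zero, then $$f^\Diamond(\mathcal A)=\mathcal E*\Big(\frac1{2\pi\mathbf i}\int_{\Gamma}f(z)(z\mathcal E-\mathcal A)^\dagger\,dz\Big)*\mathcal E .$$ In particular, if $c^{(i)}_j\ne0$ for all $1\le i\le p$, $1\le j\le r$, and $0$ is not on or inside any $\Gamma_k^{(l)}$ (so that $f(z)=1/z$ is analytic there), then $$\mathcal A^\dagger=\frac1{2\pi\mathbf i}\int_{\Gamma}\frac1z\,(z\mathcal E-\mathcal A)^\dagger\,dz .$$ -/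

import Mathlib

open scoped Matrix Kronecker BigOperators

/-! ### Third order tensors and the T-product -/

/-- A complex `m × n × p` tensor, given by its `p` frontal slices (numbered from `0`). -/
abbrev Tensor3 (m n p : ℕ) : Type := Fin p → Matrix (Fin m) (Fin n) ℂ

namespace Tensor3

variable {m n s p : ℕ}

/-- The block circulant matrix: block `(a, b)` is the frontal slice number `a - b` modulo `p`. -/
def bcirc [NeZero p] (A : Tensor3 m n p) : Matrix (Fin p × Fin m) (Fin p × Fin n) ℂ :=
  Matrix.comp _ _ _ _ _ (Matrix.circulant A)

/-- The inverse of `bcirc` on block circulant matrices: read off the first block column. -/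
def bcircInv [NeZero p] (M : Matrix (Fin p × Fin m) (Fin p × Fin n) ℂ) : Tensor3 m n p :=
  fun k => Matrix.of fun i j => M (k, i) (0, j)

theorem bcircInv_bcirc [NeZero p] (A : Tensor3 m n p) : bcircInv (bcirc A) = A := by
  funext k
  ext i j
  change A (k - 0) i j = A k i j
  rw [sub_zero]

/-- The frontal slices stacked on top of each other. -/
def unfold (A : Tensor3 m n p) : Matrix (Fin p × Fin m) (Fin n) ℂ :=
  Matrix.of fun ki j => A ki.1 ki.2 j

/-- The inverse of `unfold`. -/
def fold (M : Matrix (Fin p × Fin m) (Fin n) ℂ) : Tensor3 m n p :=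
  fun k => Matrix.of fun i j => M (k, i) j

/-- The T-product. -/
def tprod [NeZero p] (A : Tensor3 m n p) (B : Tensor3 n s p) : Tensor3 m s p :=
  fold (bcirc A * unfold B)

/-- The conjugate transpose: each slice is conjugate transposed, and the slices after the first
one are put in reverse order. -/
def ctr [NeZero p] (A : Tensor3 m n p) : Tensor3 n m p :=
  fun k => (A (-k))ᴴ

/-- The identity tensor. -/
def ident (n p : ℕ) [NeZero p] : Tensor3 n n p :=
  fun k => if k = 0 then 1 else 0

end Tensor3

infixl:70 " ∗ₜ " => Tensor3.tprod

/-! ### Moore-Penrose inverses -/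

/-- The four Penrose equations: `X` is a Moore-Penrose inverse of `M`. -/
structure IsMoorePenrose {ι κ : Type*} [Fintype ι] [Fintype κ]
    (M : Matrix ι κ ℂ) (X : Matrix κ ι ℂ) : Prop where
  mul_mul_self : M * X * M = M
  self_mul_mul : X * M * X = X
  left_herm : (M * X)ᴴ = M * X
  right_herm : (X * M)ᴴ = X * M

theorem IsMoorePenrose.unique {ι κ : Type*} [Fintype ι] [Fintype κ]
    {M : Matrix ι κ ℂ} {X Y : Matrix κ ι ℂ}
    (hX : IsMoorePenrose M X) (hY : IsMoorePenrose M Y) : X = Y := by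
  have h1 : M * X = M * Y := by
    calc M * X = M * Y * (M * X) := by rw [← Matrix.mul_assoc, hY.mul_mul_self]
      _ = (M * X * (M * Y))ᴴ := by
        rw [Matrix.conjTranspose_mul, hX.left_herm, hY.left_herm]
      _ = M * Y := by rw [← Matrix.mul_assoc, hX.mul_mul_self, hY.left_herm]
  have h2 : X * M = Y * M := by
    calc X * M = X * M * (Y * M) := by
          rw [Matrix.mul_assoc, ← Matrix.mul_assoc M, hY.mul_mul_self]
      _ = (Y * M * (X * M))ᴴ := by
        rw [Matrix.conjTranspose_mul, hX.right_herm, hY.right_herm]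
      _ = Y * M := by rw [Matrix.mul_assoc, ← Matrix.mul_assoc M, hX.mul_mul_self, hY.right_herm]
  calc X = X * M * X := hX.self_mul_mul.symm
    _ = Y * (M * X) := by rw [h2, Matrix.mul_assoc]
    _ = Y := by rw [h1, ← Matrix.mul_assoc, hY.self_mul_mul]

open scoped ComplexOrder in
theorem exists_isMoorePenrose {ι κ : Type*} [Fintype ι] [Fintype κ] (M : Matrix ι κ ℂ) :
    ∃ X, IsMoorePenrose M X := by
  classical
  obtain ⟨H, hH⟩ : ∃ H, H = Mᴴ * M := ⟨_, rfl⟩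
  have hHh : H.IsHermitian := by rw [hH]; exact Matrix.isHermitian_conjTranspose_mul_self M
  obtain ⟨G, hG1, hG2, hG3, hG4⟩ : ∃ G : Matrix κ κ ℂ,
      G * H * G = G ∧ H * G * H = H ∧ Gᴴ = G ∧ H * G = G * H := by
    let Q : Matrix κ κ ℂ := hHh.eigenvectorUnitary
    have hQ : Qᴴ * Q = 1 := Unitary.coe_star_mul_self hHh.eigenvectorUnitary
    let d : κ → ℂ := fun i => (hHh.eigenvalues i : ℂ)
    have hsp : H = Q * Matrix.diagonal d * Qᴴ := by
      have := hHh.spectral_theorem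
      rw [Unitary.conjStarAlgAut_apply] at this
      exact this
    have key : ∀ x y : κ → ℂ, (Q * Matrix.diagonal x * Qᴴ) * (Q * Matrix.diagonal y * Qᴴ)
        = Q * Matrix.diagonal (fun i => x i * y i) * Qᴴ := by
      intro x y
      calc _ = Q * Matrix.diagonal x * (Qᴴ * Q) * Matrix.diagonal y * Qᴴ := by
            simp only [Matrix.mul_assoc]
        _ = _ := by rw [hQ, Matrix.mul_one, Matrix.mul_assoc Q, Matrix.diagonal_mul_diagonal]
    refine ⟨Q * Matrix.diagonal (fun i => (d i)⁻¹) * Qᴴ, ?_, ?_, ?_, ?_⟩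
    · rw [hsp, key, key]; congr 3; funext i
      by_cases h : d i = 0 <;> simp [h]
    · rw [hsp, key, key]; congr 3; funext i
      by_cases h : d i = 0 <;> simp [h]
    · rw [Matrix.conjTranspose_mul, Matrix.conjTranspose_mul, Matrix.conjTranspose_conjTranspose,
        Matrix.diagonal_conjTranspose, Matrix.mul_assoc]
      congr 3; funext i; simp [d]
    · rw [hsp, key, key]; congr 3; funext i; rw [mul_comm]
  refine ⟨G * Mᴴ, ?_, ?_, ?_, ?_⟩
  · have h0 : (M * (G * H - 1))ᴴ * (M * (G * H - 1)) = 0 := by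
      rw [Matrix.conjTranspose_mul, Matrix.mul_assoc, ← Matrix.mul_assoc Mᴴ, ← hH,
        Matrix.mul_sub H, ← Matrix.mul_assoc H, hG2]
      simp
    have h1 := Matrix.conjTranspose_mul_self_eq_zero.1 h0
    rw [Matrix.mul_sub, Matrix.mul_one, sub_eq_zero] at h1
    rw [Matrix.mul_assoc, Matrix.mul_assoc G, ← hH, h1]
  · rw [Matrix.mul_assoc G, ← hH, ← Matrix.mul_assoc, hG1]
  · simp [Matrix.conjTranspose_mul, hG3, Matrix.mul_assoc]
  · rw [Matrix.mul_assoc, ← hH, Matrix.conjTranspose_mul, hG3, hHh.eq, hG4]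

/-- The Moore-Penrose inverse of a complex matrix. -/
noncomputable def pinv {ι κ : Type*} [Fintype ι] [Fintype κ] (M : Matrix ι κ ℂ) :
    Matrix κ ι ℂ :=
  Classical.choose (exists_isMoorePenrose M)

theorem pinv_spec {ι κ : Type*} [Fintype ι] [Fintype κ] (M : Matrix ι κ ℂ) :
    IsMoorePenrose M (pinv M) :=
  Classical.choose_spec (exists_isMoorePenrose M)

/-- The Moore-Penrose inverse of a tensor. -/
noncomputable def Tensor3.tpinv {m n p : ℕ} [NeZero p] (A : Tensor3 m n p) : Tensor3 n m p :=
  Tensor3.bcircInv (pinv (Tensor3.bcirc A))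

/-! ### Block diagonalization by the discrete Fourier transform -/

/-- The `p × p` discrete Fourier matrix, with entries `ω ^ (a * b) / √p` for
`ω = exp (-2πi / p)`. -/
noncomputable def dftMatrix (p : ℕ) : Matrix (Fin p) (Fin p) ℂ :=
  Matrix.of fun a b =>
    ((Real.sqrt p : ℝ) : ℂ)⁻¹ *
      Complex.exp (-2 * Real.pi * Complex.I / p) ^ ((a : ℕ) * (b : ℕ))

/-- `(F_p ⊗ I_m) diag(D_1, …, D_p) (F_pᴴ ⊗ I_n)` -/
noncomputable def fourierConj {m n p : ℕ} (D : Fin p → Matrix (Fin m) (Fin n) ℂ) :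
    Matrix (Fin p × Fin m) (Fin p × Fin n) ℂ :=
  (dftMatrix p ⊗ₖ (1 : Matrix (Fin m) (Fin m) ℂ))
    * Matrix.comp _ _ _ _ _ (Matrix.diagonal D)
    * ((dftMatrix p)ᴴ ⊗ₖ (1 : Matrix (Fin n) (Fin n) ℂ))

/-- `fourierConj D` is block circulant, so `bcircInv` really inverts `bcirc` there. -/
theorem bcirc_bcircInv_fourierConj {m n p : ℕ} [NeZero p] (D : Fin p → Matrix (Fin m) (Fin n) ℂ) :
    (Tensor3.bcircInv (fourierConj D)).bcirc = fourierConj D := by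
  have hp : (p : ℂ) ≠ 0 := by exact_mod_cast NeZero.ne p
  have ent : ∀ a b i j, fourierConj D (a, i) (b, j)
      = ∑ k, dftMatrix p a k * star (dftMatrix p b k) * D k i j := by
    intro a b i j
    simp only [fourierConj, Matrix.mul_apply, Matrix.kroneckerMap_apply, Matrix.comp_apply,
      Matrix.diagonal_apply, Fintype.sum_prod_type, Matrix.one_apply, Matrix.conjTranspose_apply]
    have hz : ∀ x k : Fin p, (if x = k then D x else 0) i j = if x = k then D x i j else 0 := by
      intro x k; split_ifs <;> rfl
    simp [Finset.sum_mul, hz]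
    refine Finset.sum_congr rfl fun k _ => ?_
    ring
  set w := Complex.exp (-2 * Real.pi * Complex.I / p) with hw
  have hw1 : w ^ p = 1 := by
    rw [hw, ← Complex.exp_nat_mul, Complex.exp_eq_one_iff]
    exact ⟨-1, by push_cast; field_simp⟩
  have hww : w * star w = 1 := by
    rw [hw, Complex.star_def, ← Complex.exp_conj, ← Complex.exp_add]
    simp [neg_div, Complex.conj_ofNat]
  ext ⟨a, i⟩ ⟨b, j⟩
  change fourierConj D (a - b, i) (0, j) = _
  rw [ent, ent]
  refine Finset.sum_congr rfl fun k _ => ?_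
  congr 1
  simp only [dftMatrix, Matrix.of_apply, ← hw]
  have key : w ^ (((a - b : Fin p) : ℕ) * (k : ℕ)) = w ^ ((a : ℕ) * k) * star (w ^ ((b : ℕ) * k)) := by
    have h2 : ((a - b : Fin p) : ℕ) + b ≡ a [MOD p] := by
      have : (((a - b) + b : Fin p) : ℕ) = a := by rw [sub_add_cancel]
      rw [Fin.val_add] at this
      unfold Nat.ModEq
      rw [this, Nat.mod_eq_of_lt a.isLt]
    have h3 : w ^ (((a - b : Fin p) : ℕ) * (k : ℕ)) * w ^ ((b : ℕ) * k) = w ^ ((a : ℕ) * k) := by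
      rw [← pow_add, ← add_mul, pow_mul, pow_mul, pow_eq_pow_mod _ hw1, h2, ← pow_eq_pow_mod _ hw1]
    have h4 : w ^ ((b : ℕ) * k) * star (w ^ ((b : ℕ) * k)) = 1 := by
      rw [star_pow, ← mul_pow, hww, one_pow]
    rw [← h3, mul_assoc, h4, mul_one]
  rw [key]
  simp
  ring

/-- The `m × n` diagonal matrix with diagonal `d`. -/
def rectDiag {m n : ℕ} (d : Fin (min m n) → ℂ) : Matrix (Fin m) (Fin n) ℂ :=
  Matrix.of fun a b =>
    if h : (a : ℕ) = b then d ⟨a, lt_min a.isLt (h ▸ b.isLt)⟩ else 0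

/-! ### T-SVD and T-CSVD -/

/-- A tensor singular value decomposition `A = U ∗ S ∗ Vᴴ`: `U` and `V` are unitary, `S` is
F-diagonal, and after block diagonalization by the discrete Fourier transform the `i`-th blocks
`U_i Σ_i V_iᴴ` form a singular value decomposition, in which the singular values `sv i` (the
diagonal of `Σ_i`) are non-negative and in non-increasing order. -/
structure TSVD {m n p : ℕ} [NeZero p] (A : Tensor3 m n p) where
  U : Tensor3 m m p
  S : Tensor3 m n p
  V : Tensor3 n n p
  unitary_U : U.ctr ∗ₜ U = Tensor3.ident m p ∧ U ∗ₜ U.ctr = Tensor3.ident m p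
  unitary_V : V.ctr ∗ₜ V = Tensor3.ident n p ∧ V ∗ₜ V.ctr = Tensor3.ident n p
  fdiagonal_S : ∀ (k : Fin p) (a : Fin m) (b : Fin n), (a : ℕ) ≠ b → S k a b = 0
  eq_prod : A = U ∗ₜ S ∗ₜ V.ctr
  Ublk : Fin p → Matrix (Fin m) (Fin m) ℂ
  sv : Fin p → Fin (min m n) → ℝ
  Vblk : Fin p → Matrix (Fin n) (Fin n) ℂ
  sv_nonneg : ∀ i j, 0 ≤ sv i j
  sv_antitone : ∀ i, Antitone (sv i)
  bcirc_U : U.bcirc = fourierConj Ublk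
  bcirc_S : S.bcirc = fourierConj fun i => rectDiag fun j => (sv i j : ℂ)
  bcirc_V : V.ctr.bcirc = fourierConj fun i => (Vblk i)ᴴ

namespace TSVD

variable {m n p : ℕ} [NeZero p] {A : Tensor3 m n p} (T : TSVD A)

/-- The generalized tensor function `f^◇(A) = U ∗ f̂(S) ∗ Vᴴ` computed from a T-SVD: the block
`Σ_i` is replaced by the diagonal matrix `f(√(Σ_i Σ_iᴴ)) (√(Σ_i Σ_iᴴ))† Σ_i`, that is, `f` is
applied to the non-zero singular values, and the zero singular values are kept. -/
noncomputable def tensorFun (f : ℂ → ℂ) : Tensor3 m n p :=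
  T.U ∗ₜ Tensor3.bcircInv
      (fourierConj fun i => rectDiag fun j => if T.sv i j = 0 then 0 else f (T.sv i j))
    ∗ₜ T.V.ctr

/-- The tubal rank: the largest rank of a block `Σ_i`. -/
noncomputable def tubalRank : ℕ :=
  Finset.univ.sup fun i : Fin p =>
    (rectDiag (m := m) (n := n) fun j => (T.sv i j : ℂ)).rank

theorem tubalRank_le : T.tubalRank ≤ min m n := by
  refine Finset.sup_le fun i _ => le_min ?_ ?_
  · simpa using Matrix.rank_le_card_height (rectDiag (m := m) (n := n) fun j => (T.sv i j : ℂ))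
  · simpa using Matrix.rank_le_card_width (rectDiag (m := m) (n := n) fun j => (T.sv i j : ℂ))

/-- The first `r` columns of `U_i`, where `r` is the tubal rank. -/
noncomputable def Ublkr (i : Fin p) : Matrix (Fin m) (Fin T.tubalRank) ℂ :=
  (T.Ublk i).submatrix id (Fin.castLE (T.tubalRank_le.trans (min_le_left m n)))

/-- The first `r` columns of `V_i`, where `r` is the tubal rank. -/
noncomputable def Vblkr (i : Fin p) : Matrix (Fin n) (Fin T.tubalRank) ℂ :=
  (T.Vblk i).submatrix id (Fin.castLE (T.tubalRank_le.trans (min_le_right m n)))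

/-- The numbers `c_j^{(i)}`: the diagonal of the leading `r × r` block of `Σ_i`, where `r` is the
tubal rank. Some of them may be zero. -/
noncomputable def c (i : Fin p) (j : Fin T.tubalRank) : ℝ :=
  T.sv i (Fin.castLE T.tubalRank_le j)

/-- The factor `U_(r)` of the T-CSVD `A = U_(r) ∗ S_(r) ∗ V_(r)ᴴ`. -/
noncomputable def Ur : Tensor3 m T.tubalRank p :=
  Tensor3.bcircInv (fourierConj T.Ublkr)

/-- The factor `V_(r)ᴴ` of the T-CSVD `A = U_(r) ∗ S_(r) ∗ V_(r)ᴴ`. -/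
noncomputable def VrH : Tensor3 T.tubalRank n p :=
  Tensor3.bcircInv (fourierConj fun i => (T.Vblkr i)ᴴ)

/-- The partial isometry `E = U_(r) ∗ V_(r)ᴴ`. -/
noncomputable def E : Tensor3 m n p :=
  T.Ur ∗ₜ T.VrH

/-- The partial isometry `E_j^{(i)}`: its only non-zero Fourier block is the `i`-th one, which is
`u_j^{(i)} v_j^{(i)H}`. -/
noncomputable def Eij (i : Fin p) (j : Fin T.tubalRank) : Tensor3 m n p :=
  Tensor3.bcircInv (fourierConj (Pi.single i
    (Matrix.vecMulVec (fun a => T.Ublkr i a j) (fun b => star (T.Vblkr i b j)))))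

/-- The set of the distinct `c_j^{(i)}`. -/
noncomputable def gammas : Finset ℝ :=
  Finset.univ.image fun ij : Fin p × Fin T.tubalRank => T.c ij.1 ij.2

/-- The spectral partial isometry of `g`: the sum of the `E_j^{(i)}` with `c_j^{(i)} = g`. -/
noncomputable def Ebar (g : ℝ) : Tensor3 m n p :=
  ∑ ij : Fin p × Fin T.tubalRank with T.c ij.1 ij.2 = g, T.Eij ij.1 ij.2

/-- `(z E - A)†` -/
noncomputable def resolvent (z : ℂ) : Tensor3 n m p :=
  (z • T.E - A).tpinv

end TSVD

/-! ### Contours -/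

/-- The contour integral `∫_γ g(z) dz` along a path in the complex plane. -/
noncomputable def contourIntegral {a b : ℂ} (γ : Path a b) (g : ℂ → ℂ) : ℂ :=
  curveIntegral (fun z => ContinuousLinearMap.toSpanSingleton ℂ (g z)) γ

/-- The points inside a closed path: those in a bounded connected component of the complement. -/
def pathInside {a : ℂ} (γ : Path a a) : Set ℂ :=
  {z | z ∉ Set.range γ ∧ Bornology.IsBounded (connectedComponentIn (Set.range γ)ᶜ z)}

/-- A positively oriented simple closed piecewise `C¹` contour in the complex plane. -/
structure Contour where
  base : ℂ
  path : Path base base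
  piecewise_C1 : ∃ (N : ℕ) (t : ℕ → ℝ), Monotone t ∧ t 0 = 0 ∧ t N = 1 ∧
    ∀ k < N, ContDiffOn ℝ 1 path.extend (Set.Icc (t k) (t (k + 1)))
  simple : Set.InjOn path.extend (Set.Ico 0 1)
  /-- the contour winds once, counterclockwise, around each point inside it -/
  positive : ∀ z ∈ pathInside path,
    (2 * Real.pi * Complex.I)⁻¹ * contourIntegral path (fun w => (w - z)⁻¹) = 1

namespace Contour

variable (Γ : Contour)

/-- The points inside the contour. -/
def inside : Set ℂ := pathInside Γ.path

/-- The points on or inside the contour. -/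
def onOrInside : Set ℂ := Set.range Γ.path ∪ Γ.inside

/-- The integral of a tensor-valued function along the contour, taken entrywise. -/
noncomputable def tensorIntegral {m n p : ℕ} (g : ℂ → Tensor3 m n p) : Tensor3 m n p :=
  fun k => Matrix.of fun i j => contourIntegral Γ.path fun z => g z k i j

end Contour

/-! Conjugation by the Fourier matrix turns T-products and Moore-Penrose inverses into blockwise
operations (`ofBlocks_tprod`, `tpinv_ofBlocks`). Everything then takes place among tensors `compact
d`, with blocks `X diag(d) Yᴴ`, and `cocompact d`, with blocks `Y diag(d) Xᴴ`, where `X` and `Y`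
have orthonormal columns. Here `A` has `d = c` and `E` has `d = 1`, so `(zE - A)†` is `cocompact` of
`1/(z - c)` (`resolvent_eq`), and multiplying by `E` on both sides sends `cocompact d` to `compact
d`. Integrating against `f` thus reduces to the scalar Cauchy formula for each `c`: a contour
contributes `f(c)` if it encloses `c` and nothing if `c` lies outside.

The scalar formula is Dixon's argument. The integral of `(f(w) - f(z))/(w - z)` for `z` on or inside
the contour, and of `f(w)/(w - z)` for `z` outside, glue to an entire function because the winding
number vanishes outside. This function tends to zero at infinity, so it is zero by Liouville
(`dixon_eq_zero`).

Independence of the T-SVD holds because each block of `f^◇(A)` is `q(MMᴴ)M`, where `M` is the block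
of `A` and `q` is a polynomial interpolating `f(√x)/√x` at the squared non-zero singular values
(`mul_diagonal_mul_congr`). -/

/-! ### Holomorphic dependence of integrals on a parameter. -/

open MeasureTheory in
/-- Differentiation under the integral sign for a bounded family of holomorphic functions. -/
theorem hasDerivAt_intervalIntegral_of_differentiableOn_ball {φ : ℂ → ℝ → ℂ} {D : ℝ → ℂ} {z₀ : ℂ}
    {R M : ℝ} (hR : 0 < R) (hD : IntervalIntegrable D volume 0 1)
    (hφ : ∀ t ∈ Set.Icc (0 : ℝ) 1, DifferentiableOn ℂ (fun z => φ z t) (Metric.ball z₀ R))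
    (hM : ∀ t ∈ Set.Icc (0 : ℝ) 1, ∀ z ∈ Metric.ball z₀ R, ‖φ z t‖ ≤ M)
    (hc : ∀ z ∈ Metric.ball z₀ R, ContinuousOn (φ z) (Set.Icc 0 1)) :
    HasDerivAt (fun z => ∫ t in (0 : ℝ)..1, φ z t * D t)
      (∫ t in (0 : ℝ)..1, deriv (fun z => φ z t) z₀ * D t) z₀ := by
  have hI : Set.uIoc (0 : ℝ) 1 ⊆ Set.Icc 0 1 := by
    rw [Set.uIoc_of_le zero_le_one]; exact Set.Ioc_subset_Icc_self
  have hI' : Set.uIcc (0 : ℝ) 1 = Set.Icc 0 1 := Set.uIcc_of_le zero_le_one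
  have hDm : AEStronglyMeasurable D (volume.restrict (Set.uIoc 0 1)) :=
    (intervalIntegrable_iff.1 hD).aestronglyMeasurable
  have hφm : ∀ z ∈ Metric.ball z₀ R,
      AEStronglyMeasurable (φ z) (volume.restrict (Set.uIoc 0 1)) := fun z hz =>
    ((hc z hz).mono hI).aestronglyMeasurable measurableSet_uIoc
  have hder : ∀ t ∈ Set.Icc (0 : ℝ) 1, ∀ z ∈ Metric.ball z₀ R,
      HasDerivAt (fun z => φ z t) (deriv (fun z => φ z t) z) z := fun t ht z hz =>
    ((hφ t ht).differentiableAt (Metric.isOpen_ball.mem_nhds hz)).hasDerivAt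
  -- The bound is Cauchy's estimate: a disc of radius `R / 2` about a point of the half ball stays
  -- in the full ball, where `φ` is at most `M`.
  refine (intervalIntegral.hasDerivAt_integral_of_dominated_loc_of_deriv_le
    (F := fun z t => φ z t * D t) (F' := fun z t => deriv (fun z => φ z t) z * D t)
    (bound := fun t => M / (R / 2) * ‖D t‖)
    (Metric.ball_mem_nhds z₀ (half_pos hR)) ?_ ?_ ?_ ?_ (hD.norm.const_mul _) ?_).2
  · filter_upwards [Metric.ball_mem_nhds z₀ hR] with z hz using (hφm z hz).mul hDm
  · exact hD.continuousOn_mul (hI' ▸ hc z₀ (Metric.mem_ball_self hR))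
  · refine AEStronglyMeasurable.mul ?_ hDm
    -- Measurability in `t` of the derivative: it is the pointwise limit of the difference quotients
    -- along `z₀ + s k`, each of which is measurable.
    let s : ℕ → ℂ := fun k => ((R / 2 / (k + 1) : ℝ) : ℂ)
    have hs0 : ∀ k, s k ≠ 0 := fun k => by
      simp only [s, ne_eq, Complex.ofReal_eq_zero]; positivity
    have hst : Filter.Tendsto s Filter.atTop (nhdsWithin 0 {0}ᶜ) := by
      refine tendsto_nhdsWithin_iff.2 ⟨?_, Filter.Eventually.of_forall hs0⟩
      have := tendsto_const_div_atTop_nhds_zero_nat (R / 2)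
      have h2 := (Filter.tendsto_add_atTop_iff_nat 1).2 this
      have h3 := (Complex.continuous_ofReal.tendsto 0).comp h2
      simpa [s, Function.comp_def] using h3
    have hsb : ∀ k, z₀ + s k ∈ Metric.ball z₀ R := fun k => by
      have h1 : R / 2 / (k + 1) ≤ R / 2 := div_le_self (by positivity) (by simp)
      have h0 : (0 : ℝ) ≤ R / 2 / (k + 1) := by positivity
      simp only [mem_ball_iff_norm, add_sub_cancel_left, s, Complex.norm_real, Real.norm_eq_abs,
        abs_of_nonneg h0]
      linarith
    refine aestronglyMeasurable_of_tendsto_ae Filter.atTop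
      (f := fun k t => (s k)⁻¹ • (φ (z₀ + s k) t - φ z₀ t)) (fun k => ?_) ?_
    · exact AEStronglyMeasurable.const_smul (f := fun t => φ (z₀ + s k) t - φ z₀ t)
        ((hφm _ (hsb k)).sub (hφm _ (Metric.mem_ball_self hR))) ((s k)⁻¹)
    · filter_upwards [ae_restrict_mem measurableSet_uIoc] with t ht
      exact (hder t (hI ht) z₀ (Metric.mem_ball_self hR)).tendsto_slope_zero.comp hst
  · refine Filter.Eventually.of_forall fun t ht z hz => ?_
    rw [norm_mul]
    gcongr
    have hsub : Metric.closedBall z (R / 2) ⊆ Metric.ball z₀ R := by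
      refine Metric.closedBall_subset_ball' ?_
      rw [Metric.mem_ball] at hz; linarith
    refine Complex.norm_deriv_le_of_forall_mem_sphere_norm_le (half_pos hR) ?_ fun w hw =>
      hM t (hI ht) w (hsub (Metric.sphere_subset_closedBall hw))
    refine DifferentiableOn.diffContOnCl ((hφ t (hI ht)).mono ?_)
    rwa [closure_ball z (half_pos hR).ne']
  · exact Filter.Eventually.of_forall fun t ht z hz =>
      (hder t (hI ht) z (Metric.ball_subset_ball (half_le_self hR.le) hz)).mul_const _

theorem contourIntegral_eq_intervalIntegral {a b : ℂ} (γ : Path a b) (g : ℂ → ℂ) :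
    contourIntegral γ g
      = ∫ t in (0 : ℝ)..1, g (γ.extend t) * derivWithin γ.extend (Set.Icc 0 1) t := by
  rw [contourIntegral, curveIntegral_def]
  refine intervalIntegral.integral_congr fun t _ => ?_
  simp only [curveIntegralFun_def]
  simp [ContinuousLinearMap.toSpanSingleton_apply, mul_comm]

/-! ### Cauchy transforms and winding numbers of contours. -/

namespace Contour

variable (Γ : Contour)

/-- The derivative of the parametrization of the contour. -/
noncomputable def velocity (t : ℝ) : ℂ := derivWithin Γ.path.extend (Set.Icc 0 1) t

theorem extend_mem_range (t : ℝ) : Γ.path.extend t ∈ Set.range Γ.path :=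
  Path.extend_range Γ.path ▸ Set.mem_range_self t

theorem isCompact_range : IsCompact (Set.range Γ.path) :=
  _root_.isCompact_range Γ.path.continuous

theorem intervalIntegrable_velocity :
    IntervalIntegrable Γ.velocity MeasureTheory.volume 0 1 := by
  obtain ⟨N, t, ht, h0, h1, hC⟩ := Γ.piecewise_C1
  rw [← h0, ← h1]
  refine IntervalIntegrable.trans_iterate fun k hk => ?_
  rcases (ht k.le_succ).eq_or_lt with h | h
  -- The partition is only weakly monotone, so a piece may be a single point.
  · rw [← Nat.succ_eq_add_one, ← h]
  have hc : ContinuousOn (derivWithin Γ.path.extend (Set.Icc (t k) (t (k + 1))))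
      (Set.uIcc (t k) (t (k + 1))) := by
    rw [Set.uIcc_of_le h.le]
    exact (hC k hk).continuousOn_derivWithin (uniqueDiffOn_Icc h) le_rfl
  -- The one-sided derivative along the piece agrees with the velocity except possibly at the two
  -- ends.
  refine hc.intervalIntegrable.congr_uIoo fun x hx => ?_
  rw [Set.uIoo_of_le h.le] at hx
  have hk0 : 0 ≤ t k := h0 ▸ ht (Nat.zero_le k)
  have hk1 : t (k + 1) ≤ 1 := h1 ▸ ht hk
  rw [velocity, derivWithin_of_mem_nhds (Icc_mem_nhds hx.1 hx.2),
    derivWithin_of_mem_nhds (Icc_mem_nhds (hk0.trans_lt hx.1) (hx.2.trans_le hk1))]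

theorem exists_finite_hasDerivAt : ∃ s : Set ℝ, s.Finite ∧
    ∀ x ∈ Set.Ioo (0 : ℝ) 1 \ s, HasDerivAt Γ.path.extend (Γ.velocity x) x := by
  obtain ⟨N, t, ht, h0, h1, hC⟩ := Γ.piecewise_C1
  refine ⟨t '' Set.Iic N, (Set.finite_Iic N).image t, fun x hx => ?_⟩
  obtain ⟨⟨hx0, hx1⟩, hxs⟩ := hx
  have hex : ∃ k, x < t k := ⟨N, h1 ▸ hx1⟩
  classical
  -- The first partition point beyond `x` is `t (k + 1)`, so `x` lies in the interior of piece `k`.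
  obtain ⟨k, hk⟩ : ∃ k, Nat.find hex = k + 1 := by
    refine Nat.exists_eq_succ_of_ne_zero fun h => ?_
    have := Nat.find_spec hex
    rw [h, h0] at this
    exact lt_asymm hx0 this
  have hkN : k + 1 ≤ N := hk ▸ Nat.find_min' hex (h1 ▸ hx1)
  have hxk : x < t (k + 1) := hk ▸ Nat.find_spec hex
  have hkx : t k < x := by
    refine lt_of_le_of_ne (not_lt.1 (Nat.find_min hex (hk ▸ k.lt_succ_self))) fun h => ?_
    exact hxs ⟨k, (Nat.le_succ k).trans hkN, h⟩
  have hd : DifferentiableAt ℝ Γ.path.extend x :=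
    ((hC k hkN).differentiableOn one_ne_zero).differentiableAt (Icc_mem_nhds hkx hxk)
  rw [velocity, derivWithin_of_mem_nhds (Icc_mem_nhds hx0 hx1)]
  exact hd.hasDerivAt

theorem continuousOn_comp_extend {g : ℂ → ℂ} (hg : ContinuousOn g (Set.range Γ.path)) :
    Continuous fun t => g (Γ.path.extend t) :=
  hg.comp_continuous Γ.path.continuous_extend Γ.extend_mem_range

theorem intervalIntegrable_comp_mul_velocity {g : ℂ → ℂ} (hg : ContinuousOn g (Set.range Γ.path)) :
    IntervalIntegrable (fun t => g (Γ.path.extend t) * Γ.velocity t) MeasureTheory.volume 0 1 :=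
  Γ.intervalIntegrable_velocity.continuousOn_mul (Γ.continuousOn_comp_extend hg).continuousOn

/-- The integral of a derivative along a closed contour vanishes. -/
theorem integral_deriv_eq_zero {G g : ℂ → ℂ} (hg : ContinuousOn g (Set.range Γ.path))
    (hG : ∀ w ∈ Set.range Γ.path, HasDerivAt G (g w) w) :
    ∫ t in (0 : ℝ)..1, g (Γ.path.extend t) * Γ.velocity t = 0 := by
  obtain ⟨s, hs, hd⟩ := Γ.exists_finite_hasDerivAt
  rw [MeasureTheory.integral_eq_of_hasDerivAt_off_countable_of_le
    (fun t => G (Γ.path.extend t)) _ zero_le_one hs.countable ?_ ?_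
    (Γ.intervalIntegrable_comp_mul_velocity hg)]
  -- The primitive takes equal values at both ends because the path is closed.
  · simp
  · exact (Γ.continuousOn_comp_extend
      fun w hw => (hG w hw).continuousAt.continuousWithinAt).continuousOn
  · intro x hx
    exact (hG _ (Γ.extend_mem_range x)).comp x (hd x hx)

/-- The Cauchy transform of a function on a contour. -/
noncomputable def cauchyTransform (g : ℂ → ℂ) (z : ℂ) : ℂ :=
  ∫ t in (0 : ℝ)..1, g (Γ.path.extend t) * (Γ.path.extend t - z)⁻¹ * Γ.velocity t

theorem contourIntegral_mul_inv_eq (g : ℂ → ℂ) (z : ℂ) :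
    contourIntegral Γ.path (fun w => g w * (w - z)⁻¹) = Γ.cauchyTransform g z :=
  contourIntegral_eq_intervalIntegral _ _

theorem continuousOn_mul_sub_inv {g : ℂ → ℂ} (hg : ContinuousOn g (Set.range Γ.path)) {z : ℂ}
    (hz : z ∉ Set.range Γ.path) : ContinuousOn (fun w => g w * (w - z)⁻¹) (Set.range Γ.path) :=
  hg.mul ((continuousOn_id.sub continuousOn_const).inv₀ fun w hw h =>
    hz ((sub_eq_zero.1 h : w = z) ▸ hw))

theorem exists_bound {g : ℂ → ℂ} (hg : ContinuousOn g (Set.range Γ.path)) :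
    ∃ M, ∀ w ∈ Set.range Γ.path, ‖g w‖ ≤ M :=
  Γ.isCompact_range.exists_bound_of_continuousOn hg

theorem hasDerivAt_cauchyTransform {g : ℂ → ℂ} (hg : ContinuousOn g (Set.range Γ.path)) {z : ℂ}
    (hz : z ∉ Set.range Γ.path) :
    HasDerivAt (Γ.cauchyTransform g)
      (∫ t in (0 : ℝ)..1, g (Γ.path.extend t) * ((Γ.path.extend t - z) ^ 2)⁻¹ * Γ.velocity t) z := by
  obtain ⟨M, hM⟩ := Γ.exists_bound hg
  -- Halving a disc that misses the curve keeps the denominators at least `ε / 2`, uniformly in both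
  -- variables.
  obtain ⟨ε, hε, hb⟩ := Metric.isOpen_iff.1 Γ.isCompact_range.isClosed.isOpen_compl z hz
  have hsub : ∀ u ∈ Metric.ball z (ε / 2), ∀ w ∈ Set.range Γ.path, ε / 2 ≤ ‖w - u‖ := by
    intro u hu w hw
    by_contra! h
    refine hb (?_ : w ∈ Metric.ball z ε) hw
    have := dist_triangle w u z
    rw [Metric.mem_ball] at hu ⊢
    rw [dist_eq_norm w u] at this
    linarith
  have hne : ∀ u ∈ Metric.ball z (ε / 2), ∀ w ∈ Set.range Γ.path, w - u ≠ 0 := fun u hu w hw =>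
    norm_pos_iff.1 ((half_pos hε).trans_le (hsub u hu w hw))
  have hd : ∀ t : ℝ, ∀ u ∈ Metric.ball z (ε / 2),
      HasDerivAt (fun u => g (Γ.path.extend t) * (Γ.path.extend t - u)⁻¹)
        (g (Γ.path.extend t) * ((Γ.path.extend t - u) ^ 2)⁻¹) u := by
    intro t u hu
    have h1 := ((hasDerivAt_id u).const_sub (Γ.path.extend t)).fun_inv
      (hne u hu _ (Γ.extend_mem_range t))
    exact (h1.const_mul (g (Γ.path.extend t))).congr_deriv (by simp)
  have key := hasDerivAt_intervalIntegral_of_differentiableOn_ball (half_pos hε)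
    Γ.intervalIntegrable_velocity
    (φ := fun u t => g (Γ.path.extend t) * (Γ.path.extend t - u)⁻¹) (M := M * (ε / 2)⁻¹)
    (fun t _ u hu => (hd t u hu).differentiableAt.differentiableWithinAt) ?_ ?_
  · simp only [fun t => (hd t z (Metric.mem_ball_self (half_pos hε))).deriv] at key
    exact key
  · intro t _ u hu
    rw [norm_mul, norm_inv]
    have h1 := hM _ (Γ.extend_mem_range t)
    have h2 := hsub u hu _ (Γ.extend_mem_range t)
    have h3 := (norm_nonneg _).trans h1
    gcongr
  · intro u hu
    exact (Γ.continuousOn_comp_extend (Γ.continuousOn_mul_sub_inv hg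
      fun h => hne u hu u h (sub_self u))).continuousOn

/-- If the curve lies in the disc of radius `B`, the kernel is at most `1 / (‖z‖ - B)`. This decay
serves both Liouville's theorem and the vanishing of the winding number outside. -/
theorem tendsto_cauchyTransform_cocompact {g : ℂ → ℂ} (hg : ContinuousOn g (Set.range Γ.path)) :
    Filter.Tendsto (Γ.cauchyTransform g) (Filter.cocompact ℂ) (nhds 0) := by
  obtain ⟨M, hM⟩ := Γ.exists_bound hg
  obtain ⟨B, hB⟩ := Γ.exists_bound continuousOn_id
  have hM0 : 0 ≤ M := (norm_nonneg _).trans (hM _ (Γ.extend_mem_range 0))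
  have hL : Filter.Tendsto (fun z : ℂ => ∫ t in (0 : ℝ)..1, M * (‖z‖ - B)⁻¹ * ‖Γ.velocity t‖)
      (Filter.cocompact ℂ) (nhds 0) := by
    simp only [intervalIntegral.integral_const_mul]
    have h1 : Filter.Tendsto (fun z : ℂ => (‖z‖ - B)⁻¹) (Filter.cocompact ℂ) (nhds 0) :=
      tendsto_inv_atTop_zero.comp
        (Filter.tendsto_atTop_add_const_right _ (-B) tendsto_norm_cocompact_atTop)
    simpa using (h1.const_mul M).mul_const (∫ t in (0 : ℝ)..1, ‖Γ.velocity t‖)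
  refine squeeze_zero_norm' ?_ hL
  filter_upwards [tendsto_norm_cocompact_atTop.eventually_gt_atTop B] with z hz
  refine intervalIntegral.norm_integral_le_of_norm_le zero_le_one
    (Filter.Eventually.of_forall fun t _ => ?_)
    (Γ.intervalIntegrable_velocity.norm.const_mul _)
  rw [norm_mul, norm_mul, norm_inv]
  have h1 := hM _ (Γ.extend_mem_range t)
  have h2 : ‖z‖ - B ≤ ‖Γ.path.extend t - z‖ := by
    have h3 : ‖Γ.path.extend t‖ ≤ B := hB _ (Γ.extend_mem_range t)
    have := norm_sub_norm_le z (Γ.path.extend t)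
    rw [norm_sub_rev] at this
    linarith
  have h4 : 0 < ‖z‖ - B := sub_pos.2 hz
  gcongr

/-- `2πi` times the winding number. -/
noncomputable def winding (z : ℂ) : ℂ := Γ.cauchyTransform (fun _ => 1) z

/-- The differentiated kernel `1 / (w - z) ^ 2` has the primitive `-1 / (w - z)` along the closed
curve. -/
theorem hasDerivAt_winding {z : ℂ} (hz : z ∉ Set.range Γ.path) : HasDerivAt Γ.winding 0 z := by
  have key := Γ.hasDerivAt_cauchyTransform (g := fun _ => 1) continuousOn_const hz
  suffices h : ∫ t in (0 : ℝ)..1,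
      1 * ((Γ.path.extend t - z) ^ 2)⁻¹ * Γ.velocity t = 0 by rwa [h] at key
  have hne : ∀ w ∈ Set.range Γ.path, w - z ≠ 0 := fun w hw h => hz (sub_eq_zero.1 h ▸ hw)
  refine (Γ.integral_deriv_eq_zero (G := fun w => -(w - z)⁻¹)
    (g := fun w => 1 * ((w - z) ^ 2)⁻¹) ?_ fun w hw => ?_)
  · exact continuousOn_const.mul (((continuousOn_id.sub continuousOn_const).pow 2).inv₀
      fun w hw => pow_ne_zero 2 (hne w hw))
  · exact (((hasDerivAt_id w).sub_const z).fun_inv (hne w hw)).fun_neg.congr_deriv (by simp [neg_div])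

theorem winding_of_mem_inside {z : ℂ} (hz : z ∈ Γ.inside) :
    Γ.winding z = 2 * Real.pi * Complex.I := by
  have h := Γ.positive z hz
  have h2 := Γ.contourIntegral_mul_inv_eq (fun _ => 1) z
  simp only [one_mul] at h2
  rw [h2] at h
  exact (inv_mul_eq_one₀ Complex.two_pi_I_ne_zero).1 h |>.symm

theorem notMem_onOrInside {z : ℂ} : z ∉ Γ.onOrInside ↔ z ∉ Set.range Γ.path ∧
    ¬ Bornology.IsBounded (connectedComponentIn (Set.range Γ.path)ᶜ z) := by
  simp only [onOrInside, inside, pathInside, Set.mem_union, Set.mem_ofPred_eq]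
  tauto

theorem isOpen_component (z : ℂ) : IsOpen (connectedComponentIn (Set.range Γ.path)ᶜ z) :=
  Γ.isCompact_range.isClosed.isOpen_compl.connectedComponentIn

theorem isOpen_compl_onOrInside : IsOpen Γ.onOrInsideᶜ := by
  refine isOpen_iff_mem_nhds.2 fun z hz => ?_
  obtain ⟨h1, h2⟩ := Γ.notMem_onOrInside.1 hz
  filter_upwards [(Γ.isOpen_component z).mem_nhds (mem_connectedComponentIn h1)] with w hw
  refine Γ.notMem_onOrInside.2 ⟨connectedComponentIn_subset _ _ hw, ?_⟩
  rwa [← connectedComponentIn_eq hw]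

/-- The winding number is constant on the component of `z`, which is unbounded and so contains
points arbitrarily far out, where the winding number tends to zero. -/
theorem winding_of_notMem {z : ℂ} (hz : z ∉ Γ.onOrInside) : Γ.winding z = 0 := by
  obtain ⟨h1, h2⟩ := Γ.notMem_onOrInside.1 hz
  set C := connectedComponentIn (Set.range Γ.path)ᶜ z
  have hmem : ∀ w ∈ C, w ∉ Set.range Γ.path := fun w hw => connectedComponentIn_subset _ _ hw
  have hconst : ∀ w ∈ C, Γ.winding w = Γ.winding z := fun w hw =>
    (Γ.isOpen_component z).is_const_of_deriv_eq_zero isPreconnected_connectedComponentIn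
      (fun u hu => (Γ.hasDerivAt_winding (hmem u hu)).differentiableAt.differentiableWithinAt)
      (fun u hu => (Γ.hasDerivAt_winding (hmem u hu)).deriv) hw (mem_connectedComponentIn h1)
  have hfr : ∃ᶠ w in Filter.cocompact ℂ, w ∈ C := by
    intro h
    refine h2 (Metric.cobounded_eq_cocompact (α := ℂ) ▸ h : _ ∈ Bornology.cobounded ℂ) |>.elim
  have hT := Γ.tendsto_cauchyTransform_cocompact (g := fun _ => 1) continuousOn_const
  by_contra hne
  exact hfr ((hT.eventually_ne (Ne.symm hne)).mono fun w hw hC => hw (hconst w hC))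

/-- The quantity `winding` is `2πi` throughout the inside but tends to zero at infinity, so the
inside cannot reach infinity. -/
theorem eventually_notMem_onOrInside : ∀ᶠ z in Filter.cocompact ℂ, z ∉ Γ.onOrInside := by
  have hT := Γ.tendsto_cauchyTransform_cocompact (g := fun _ => 1) continuousOn_const
  filter_upwards [hT.eventually_ne Complex.two_pi_I_ne_zero.symm,
    Γ.isCompact_range.compl_mem_cocompact] with z h1 h2 h3
  rcases h3 with h3 | h3
  · exact h2 h3
  · exact h1 (Γ.winding_of_mem_inside h3)

end Contour

/-! ### Dixon's proof of the Cauchy integral formula. -/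

/-- Symmetry lets the difference quotient be treated as holomorphic in the parameter and as
continuous along the curve. -/
theorem dslope_comm {f : ℂ → ℂ} (a b : ℂ) : dslope f a b = dslope f b a := by
  rcases eq_or_ne a b with rfl | h
  · rfl
  · rw [dslope_of_ne _ h.symm, dslope_of_ne _ h, slope_comm]

/-- The difference quotients of a holomorphic function are bounded near a point, uniformly in the
base point running through a set on which the function is bounded. -/
theorem exists_bound_dslope {f : ℂ → ℂ} {Ω K : Set ℂ} (hΩ : IsOpen Ω)
    (hf : DifferentiableOn ℂ f Ω) {z₀ : ℂ} (hz₀ : z₀ ∈ Ω) {B : ℝ} (hB : ∀ w ∈ K, ‖f w‖ ≤ B) :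
    ∃ R > 0, Metric.ball z₀ R ⊆ Ω ∧ ∃ M, ∀ z ∈ Metric.ball z₀ R, ∀ w ∈ K,
      ‖dslope f w z‖ ≤ M := by
  have hdc : ContinuousAt (deriv f) z₀ :=
    (hf.analyticAt (hΩ.mem_nhds hz₀)).deriv.continuousAt
  obtain ⟨ε, hε, hb⟩ := Metric.eventually_nhds_iff_ball.1
    ((hΩ.eventually_mem hz₀).and
      ((hdc.norm.eventually (gt_mem_nhds (lt_add_one ‖deriv f z₀‖))).and
        ((hf.differentiableAt (hΩ.mem_nhds hz₀)).continuousAt.norm.eventually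
          (gt_mem_nhds (lt_add_one ‖f z₀‖)))))
  have hsub : Metric.ball z₀ (ε / 2) ⊆ Metric.ball z₀ ε :=
    Metric.ball_subset_ball (half_le_self hε.le)
  have hε2 := half_pos hε
  refine ⟨ε / 2, hε2, fun z hz => (hb z (hsub hz)).1,
    max (‖deriv f z₀‖ + 1) ((‖f z₀‖ + 1 + B) / (ε / 2)), fun z hz w hw => ?_⟩
  -- For `w` near `z₀` the mean value inequality bounds the quotient; for `w` far away the
  -- denominator is at least `ε / 2`.
  by_cases hwb : w ∈ Metric.ball z₀ ε
  · refine le_max_of_le_left ?_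
    rcases eq_or_ne z w with rfl | hne
    · rw [dslope_same]; exact (hb z hwb).2.1.le
    · rw [dslope_of_ne _ hne, slope_def_field, norm_div, div_le_iff₀ (norm_pos_iff.2 (sub_ne_zero.2 hne))]
      exact (convex_ball z₀ ε).norm_image_sub_le_of_norm_deriv_le
        (fun u hu => hf.differentiableAt (hΩ.mem_nhds (hb u hu).1))
        (fun u hu => (hb u hu).2.1.le) hwb (hsub hz)
  · refine le_max_of_le_right ?_
    have hd : ε / 2 ≤ ‖z - w‖ := by
      rw [Metric.mem_ball] at hwb hz
      have := dist_triangle w z z₀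
      rw [dist_comm w z, dist_eq_norm z w] at this
      linarith
    have hne : z ≠ w := fun h => by
      rw [h, sub_self, norm_zero] at hd; linarith
    have hfz := (hb z (hsub hz)).2.2.le
    have hfw := hB w hw
    rw [dslope_of_ne _ hne, slope_def_field, norm_div]
    have h0 := norm_nonneg (f w)
    have h1 := norm_nonneg (f z₀)
    have h2 : ‖f z - f w‖ ≤ ‖f z₀‖ + 1 + B := (norm_sub_le _ _).trans (by linarith)
    have h3 : 0 ≤ ‖f z₀‖ + 1 + B := by linarith
    gcongr

namespace Contour

variable (Γ : Contour)

/-- The integral of the difference quotients of `f` along the contour. -/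
noncomputable def slopeTransform (f : ℂ → ℂ) (z : ℂ) : ℂ :=
  ∫ t in (0 : ℝ)..1, dslope f (Γ.path.extend t) z * Γ.velocity t

theorem differentiableAt_slopeTransform {f : ℂ → ℂ} {Ω : Set ℂ} (hΩ : IsOpen Ω)
    (hf : DifferentiableOn ℂ f Ω) (hΓ : Set.range Γ.path ⊆ Ω) {z : ℂ} (hz : z ∈ Ω) :
    DifferentiableAt ℂ (Γ.slopeTransform f) z := by
  obtain ⟨B, hB⟩ := Γ.exists_bound (hf.continuousOn.mono hΓ)
  obtain ⟨R, hR, hRΩ, M, hM⟩ := exists_bound_dslope hΩ hf hz hB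
  refine (hasDerivAt_intervalIntegral_of_differentiableOn_ball hR Γ.intervalIntegrable_velocity
    (φ := fun z t => dslope f (Γ.path.extend t) z) (M := M) (fun t _ => ?_)
    (fun t _ u hu => hM u hu _ (Γ.extend_mem_range t)) fun u hu => ?_).differentiableAt
  · exact ((Complex.differentiableOn_dslope
      (hΩ.mem_nhds (hΓ (Γ.extend_mem_range t)))).2 hf).mono hRΩ
  -- With the variables swapped, continuity in the curve point includes the case where the curve
  -- passes through `u`.
  · simp only [dslope_comm _ u]
    refine (Γ.continuousOn_comp_extend (g := dslope f u) ?_).continuousOn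
    exact ((continuousOn_dslope (hΩ.mem_nhds (hRΩ hu))).2 ⟨hf.continuousOn,
      hf.differentiableAt (hΩ.mem_nhds (hRΩ hu))⟩).mono hΓ

theorem slopeTransform_eq {f : ℂ → ℂ} (hf : ContinuousOn f (Set.range Γ.path)) {z : ℂ}
    (hz : z ∉ Set.range Γ.path) :
    Γ.slopeTransform f z = Γ.cauchyTransform f z - f z * Γ.winding z := by
  rw [slopeTransform, winding, cauchyTransform, cauchyTransform,
    ← intervalIntegral.integral_const_mul, ← intervalIntegral.integral_sub]
  · refine intervalIntegral.integral_congr fun t _ => ?_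
    have hne : Γ.path.extend t ≠ z := fun h => hz (h ▸ Γ.extend_mem_range t)
    simp only [dslope_comm _ z, dslope_of_ne f hne, slope_def_field]
    ring
  · exact Γ.intervalIntegrable_comp_mul_velocity (Γ.continuousOn_mul_sub_inv hf hz)
  · exact (Γ.intervalIntegrable_comp_mul_velocity
      (Γ.continuousOn_mul_sub_inv (g := fun _ => 1) continuousOn_const hz)).const_mul _

theorem range_subset_onOrInside : Set.range Γ.path ⊆ Γ.onOrInside := Set.subset_union_left

open Classical in
/-- Dixon's entire function vanishes. -/
theorem dixon_eq_zero {f : ℂ → ℂ} (hf : AnalyticOnNhd ℂ f Γ.onOrInside) (z : ℂ) :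
    (if z ∈ Γ.onOrInside then Γ.slopeTransform f z else Γ.cauchyTransform f z) = 0 := by
  set h : ℂ → ℂ := fun z =>
    if z ∈ Γ.onOrInside then Γ.slopeTransform f z else Γ.cauchyTransform f z with hdef
  -- The analyticity set is an open neighbourhood of the contour and its inside.
  have hΩ : IsOpen {z | AnalyticAt ℂ f z} := isOpen_analyticAt ℂ f
  have hfΩ : DifferentiableOn ℂ f {z | AnalyticAt ℂ f z} := fun u hu =>
    (hu : AnalyticAt ℂ f u).differentiableAt.differentiableWithinAt
  have hΓ : Set.range Γ.path ⊆ {z | AnalyticAt ℂ f z} := fun u hu =>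
    hf u (Γ.range_subset_onOrInside hu)
  have hfc : ContinuousOn f (Set.range Γ.path) := hfΩ.continuousOn.mono hΓ
  have hd : Differentiable ℂ h := by
    intro u
    by_cases hu : u ∈ Γ.onOrInside
    · refine (Γ.differentiableAt_slopeTransform hΩ hfΩ hΓ (hf u hu)).congr_of_eventuallyEq ?_
      filter_upwards [hΩ.mem_nhds (hf u hu)] with v hv
      by_cases hvK : v ∈ Γ.onOrInside
      · simp [hdef, hvK]
      · simp only [hdef, hvK, if_false]
        -- The two branches differ by `f v` times the winding quantity, which is zero here; hence
        -- they glue holomorphically.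
        rw [Γ.slopeTransform_eq hfc (Γ.notMem_onOrInside.1 hvK).1, Γ.winding_of_notMem hvK,
          mul_zero, sub_zero]
    · refine (Γ.hasDerivAt_cauchyTransform hfc
        (Γ.notMem_onOrInside.1 hu).1).differentiableAt.congr_of_eventuallyEq ?_
      filter_upwards [Γ.isOpen_compl_onOrInside.mem_nhds hu] with v hv
      simp only [hdef, if_neg (show v ∉ Γ.onOrInside from hv)]
  -- Liouville: near infinity only the Cauchy transform branch is active, and it decays.
  refine hd.apply_eq_of_tendsto_cocompact z
    ((Γ.tendsto_cauchyTransform_cocompact hfc).congr' ?_)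
  filter_upwards [Γ.eventually_notMem_onOrInside] with v hv
  simp only [hdef, if_neg hv]

/-- **Cauchy's integral formula** for a simple closed contour. -/
theorem cauchyTransform_of_mem_inside {f : ℂ → ℂ} (hf : AnalyticOnNhd ℂ f Γ.onOrInside) {z : ℂ}
    (hz : z ∈ Γ.inside) : Γ.cauchyTransform f z = 2 * Real.pi * Complex.I * f z := by
  have h := Γ.dixon_eq_zero hf z
  rw [if_pos (show z ∈ Γ.onOrInside from Or.inr hz), Γ.slopeTransform_eq
    (fun u hu => (hf u (Γ.range_subset_onOrInside hu)).continuousAt.continuousWithinAt) hz.1,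
    Γ.winding_of_mem_inside hz, sub_eq_zero] at h
  rw [h, mul_comm]

/-- **Cauchy's integral theorem** for a point outside a simple closed contour. -/
theorem cauchyTransform_of_notMem {f : ℂ → ℂ} (hf : AnalyticOnNhd ℂ f Γ.onOrInside) {z : ℂ}
    (hz : z ∉ Γ.onOrInside) : Γ.cauchyTransform f z = 0 := by
  simpa [if_neg hz] using Γ.dixon_eq_zero hf z

/-- The integral of a finite combination of simple fractions times a function. -/
theorem contourIntegral_sum_mul {ι : Type*} (s : Finset ι) {f : ℂ → ℂ}
    (hf : ContinuousOn f (Set.range Γ.path)) (a c : ι → ℂ)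
    (hc : ∀ i ∈ s, c i ∉ Set.range Γ.path) :
    contourIntegral Γ.path (fun z => ∑ i ∈ s, f z * (z - c i)⁻¹ * a i)
      = ∑ i ∈ s, Γ.cauchyTransform f (c i) * a i := by
  rw [contourIntegral_eq_intervalIntegral]
  simp only [cauchyTransform, Finset.sum_mul, ← intervalIntegral.integral_mul_const]
  rw [← intervalIntegral.integral_finsetSum]
  · refine intervalIntegral.integral_congr fun t _ => Finset.sum_congr rfl fun i _ => ?_
    simp only [velocity]
    ring
  · exact fun i hi => (Γ.intervalIntegrable_comp_mul_velocity
      (Γ.continuousOn_mul_sub_inv hf (hc i hi))).mul_const _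

end Contour

/-! ### Block diagonalization of tensors -/

/-- Each entry is a geometric sum over the powers of a `p`-th root of unity, which differs from 1
off the diagonal because `w` is primitive. -/
theorem dftMatrix_conjTranspose_mul (p : ℕ) [NeZero p] : (dftMatrix p)ᴴ * dftMatrix p = 1 := by
  have hp : (p : ℂ) ≠ 0 := by exact_mod_cast NeZero.ne p
  have hprim : IsPrimitiveRoot (Complex.exp (-2 * Real.pi * Complex.I / p)) p := by
    have h := (Complex.isPrimitiveRoot_exp p (NeZero.ne p)).inv
    rw [← Complex.exp_neg] at h
    rwa [show -2 * (Real.pi : ℂ) * Complex.I / p = -(2 * Real.pi * Complex.I / p) by ring]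
  set w := Complex.exp (-2 * Real.pi * Complex.I / p) with hw
  have hw0 : w ≠ 0 := Complex.exp_ne_zero _
  have hstar : star w = w⁻¹ := by
    rw [hw, Complex.star_def, ← Complex.exp_conj, ← Complex.exp_neg]
    simp [neg_div, Complex.conj_ofNat]
  have hsq : (((Real.sqrt p : ℝ) : ℂ)⁻¹) * ((Real.sqrt p : ℝ) : ℂ)⁻¹ = (p : ℂ)⁻¹ := by
    rw [← mul_inv, ← Complex.ofReal_mul, Real.mul_self_sqrt (Nat.cast_nonneg p),
      Complex.ofReal_natCast]
  ext a b
  have hterm : ∀ k : Fin p, (dftMatrix p)ᴴ a k * dftMatrix p k b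
      = (p : ℂ)⁻¹ * ((w ^ (a : ℕ))⁻¹ * w ^ (b : ℕ)) ^ (k : ℕ) := by
    intro k
    simp only [dftMatrix, Matrix.conjTranspose_apply, Matrix.of_apply, ← hw, star_mul', star_pow,
      hstar, ← hsq]
    rw [mul_pow, inv_pow, inv_pow, ← pow_mul, ← pow_mul, mul_comm (a : ℕ), mul_comm (b : ℕ)]
    simp
    ring
  rw [Matrix.mul_apply, Finset.sum_congr rfl fun k _ => hterm k, ← Finset.mul_sum,
    Fin.sum_univ_eq_sum_range (fun k => ((w ^ (a : ℕ))⁻¹ * w ^ (b : ℕ)) ^ k) p]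
  rcases eq_or_ne a b with rfl | hab
  · simp [inv_mul_cancel₀ (pow_ne_zero _ hw0), hp]
  · rw [Matrix.one_apply_ne hab]
    set y := (w ^ (a : ℕ))⁻¹ * w ^ (b : ℕ)
    have hy1 : y ≠ 1 := fun h => hab <| Fin.ext <|
      hprim.pow_inj a.isLt b.isLt ((inv_mul_eq_one₀ (pow_ne_zero _ hw0)).1 h)
    have hyp : y ^ p = 1 := by
      rw [mul_pow, inv_pow, ← pow_mul, ← pow_mul, mul_comm, mul_comm _ p, mul_comm _ p, pow_mul,
        pow_mul, hprim.pow_eq_one]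
      simp
    rw [geom_sum_eq hy1, hyp, sub_self, zero_div, mul_zero]

theorem fourierConj_apply {m n p : ℕ} (D : Fin p → Matrix (Fin m) (Fin n) ℂ) (a b : Fin p)
    (i : Fin m) (j : Fin n) : fourierConj D (a, i) (b, j)
      = ∑ k, dftMatrix p a k * star (dftMatrix p b k) * D k i j := by
  have hz : ∀ x k : Fin p, (if x = k then D x else 0) i j = if x = k then D x i j else 0 := by
    intro x k; split_ifs <;> rfl
  simp only [fourierConj, Matrix.mul_apply, Matrix.kroneckerMap_apply, Matrix.comp_apply,
    Matrix.diagonal_apply, Fintype.sum_prod_type, Matrix.one_apply, Matrix.conjTranspose_apply]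
  simp [Finset.sum_mul, hz]
  exact Finset.sum_congr rfl fun k _ => by ring

theorem comp_diagonal_mul {m n s p : ℕ} (D : Fin p → Matrix (Fin m) (Fin n) ℂ)
    (D' : Fin p → Matrix (Fin n) (Fin s) ℂ) :
    Matrix.comp _ _ _ _ _ (Matrix.diagonal D) * Matrix.comp _ _ _ _ _ (Matrix.diagonal D')
      = Matrix.comp _ _ _ _ _ (Matrix.diagonal fun i => D i * D' i) := by
  ext ⟨a, i⟩ ⟨b, j⟩
  simp only [Matrix.mul_apply, Matrix.comp_apply, Matrix.diagonal_apply, Fintype.sum_prod_type]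
  rw [Finset.sum_eq_single a]
  · by_cases h : a = b
    · subst h; simp [Matrix.mul_apply]
    · simp [h]
  · intro x _ hx
    simp [Ne.symm hx]
  · simp

theorem dft_kronecker_conjTranspose_mul (p n : ℕ) [NeZero p] :
    ((dftMatrix p)ᴴ ⊗ₖ (1 : Matrix (Fin n) (Fin n) ℂ))
      * (dftMatrix p ⊗ₖ (1 : Matrix (Fin n) (Fin n) ℂ)) = 1 := by
  rw [← Matrix.mul_kronecker_mul, dftMatrix_conjTranspose_mul, one_mul, Matrix.one_kronecker_one]

theorem fourierConj_mul {m n s p : ℕ} [NeZero p] (D : Fin p → Matrix (Fin m) (Fin n) ℂ)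
    (D' : Fin p → Matrix (Fin n) (Fin s) ℂ) :
    fourierConj D * fourierConj D' = fourierConj fun i => D i * D' i := by
  simp only [fourierConj, ← comp_diagonal_mul, Matrix.mul_assoc]
  rw [← Matrix.mul_assoc ((dftMatrix p)ᴴ ⊗ₖ (1 : Matrix (Fin n) (Fin n) ℂ)),
    dft_kronecker_conjTranspose_mul, Matrix.one_mul]

theorem fourierConj_conjTranspose {m n p : ℕ} (D : Fin p → Matrix (Fin m) (Fin n) ℂ) :
    (fourierConj D)ᴴ = fourierConj fun i => (D i)ᴴ := by
  ext ⟨a, i⟩ ⟨b, j⟩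
  simp only [Matrix.conjTranspose_apply, fourierConj_apply, star_sum, star_mul', star_star]
  exact Finset.sum_congr rfl fun k _ => by ring

theorem fourierConj_injective {m n p : ℕ} [NeZero p] :
    Function.Injective (fourierConj : (Fin p → Matrix (Fin m) (Fin n) ℂ) → _) := by
  intro D D' h
  have key : ∀ D : Fin p → Matrix (Fin m) (Fin n) ℂ,
      ((dftMatrix p)ᴴ ⊗ₖ (1 : Matrix (Fin m) (Fin m) ℂ)) * fourierConj D
        * (dftMatrix p ⊗ₖ (1 : Matrix (Fin n) (Fin n) ℂ))
      = Matrix.comp _ _ _ _ _ (Matrix.diagonal D) := by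
    intro D
    rw [fourierConj, Matrix.mul_assoc, Matrix.mul_assoc _ _ (dftMatrix p ⊗ₖ _),
      dft_kronecker_conjTranspose_mul, Matrix.mul_one, ← Matrix.mul_assoc,
      dft_kronecker_conjTranspose_mul, Matrix.one_mul]
  have h2 := key D
  rw [h, key D'] at h2
  exact Matrix.diagonal_injective ((Matrix.comp _ _ _ _ _).injective h2).symm

theorem fourierConj_one {m p : ℕ} [NeZero p] :
    fourierConj (fun _ : Fin p => (1 : Matrix (Fin m) (Fin m) ℂ)) = 1 := by
  have hF : dftMatrix p * (dftMatrix p)ᴴ = 1 :=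
    mul_eq_one_comm.1 (dftMatrix_conjTranspose_mul p)
  have h1 : Matrix.comp (Fin p) (Fin p) (Fin m) (Fin m) ℂ (Matrix.diagonal fun _ => 1) = 1 := by
    ext ⟨a, i⟩ ⟨b, j⟩
    by_cases h : a = b
    · subst h
      simp [Matrix.one_apply]
    · simp [h]
  rw [fourierConj, h1, Matrix.mul_one, ← Matrix.mul_kronecker_mul, hF, one_mul,
    Matrix.one_kronecker_one]

namespace Tensor3

variable {m n s p : ℕ} [NeZero p]

/-- The tensor with given Fourier blocks. -/
noncomputable def ofBlocks (D : Fin p → Matrix (Fin m) (Fin n) ℂ) : Tensor3 m n p :=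
  bcircInv (fourierConj D)

theorem bcirc_injective :
    Function.Injective (bcirc : Tensor3 m n p → Matrix (Fin p × Fin m) (Fin p × Fin n) ℂ) :=
  Function.LeftInverse.injective bcircInv_bcirc

theorem bcirc_ofBlocks (D : Fin p → Matrix (Fin m) (Fin n) ℂ) :
    (ofBlocks D).bcirc = fourierConj D :=
  bcirc_bcircInv_fourierConj D

theorem ofBlocks_injective :
    Function.Injective (ofBlocks : (Fin p → Matrix (Fin m) (Fin n) ℂ) → Tensor3 m n p) := by
  intro D D' h
  apply fourierConj_injective
  rw [← bcirc_ofBlocks, h, bcirc_ofBlocks]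

theorem eq_ofBlocks {A : Tensor3 m n p} {D : Fin p → Matrix (Fin m) (Fin n) ℂ}
    (h : A.bcirc = fourierConj D) : A = ofBlocks D :=
  bcirc_injective (h.trans (bcirc_ofBlocks D).symm)

theorem bcirc_tprod (A : Tensor3 m n p) (B : Tensor3 n s p) :
    (A ∗ₜ B).bcirc = A.bcirc * B.bcirc := by
  ext ⟨a, i⟩ ⟨b, j⟩
  change ∑ kl : Fin p × Fin n, A (a - b - kl.1) i kl.2 * B kl.1 kl.2 j
    = ∑ kl : Fin p × Fin n, A (a - kl.1) i kl.2 * B (kl.1 - b) kl.2 j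
  rw [Fintype.sum_prod_type, Fintype.sum_prod_type]
  -- The shift `k ↦ k + b` of the cyclic index matches the two convolutions.
  refine Fintype.sum_equiv (Equiv.addRight b) _ _ fun k => ?_
  simp [sub_sub, add_comm b k]

theorem bcirc_ctr (A : Tensor3 m n p) : A.ctr.bcirc = A.bcircᴴ := by
  ext ⟨a, i⟩ ⟨b, j⟩
  change star (A (-(a - b)) j i) = star (A (b - a) j i)
  rw [neg_sub]

theorem bcirc_ident : (ident n p).bcirc = 1 := by
  ext ⟨a, i⟩ ⟨b, j⟩
  change (ident n p (a - b)) i j = _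
  by_cases h : a = b
  · subst h; simp [ident, Matrix.one_apply]
  · simp [ident, sub_eq_zero, h]

theorem ofBlocks_tprod (D : Fin p → Matrix (Fin m) (Fin n) ℂ)
    (D' : Fin p → Matrix (Fin n) (Fin s) ℂ) :
    ofBlocks D ∗ₜ ofBlocks D' = ofBlocks fun i => D i * D' i := by
  apply bcirc_injective
  rw [bcirc_tprod, bcirc_ofBlocks, bcirc_ofBlocks, bcirc_ofBlocks, fourierConj_mul]

theorem ofBlocks_apply (D : Fin p → Matrix (Fin m) (Fin n) ℂ) (k : Fin p) (i : Fin m) (j : Fin n) :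
    ofBlocks D k i j = ∑ l, dftMatrix p k l * star (dftMatrix p 0 l) * D l i j :=
  fourierConj_apply D k 0 i j

theorem ofBlocks_smul (z : ℂ) (D : Fin p → Matrix (Fin m) (Fin n) ℂ) :
    ofBlocks (z • D) = z • ofBlocks D := by
  ext k i j
  simp only [ofBlocks_apply, Pi.smul_apply, Matrix.smul_apply, smul_eq_mul, Finset.mul_sum]
  exact Finset.sum_congr rfl fun l _ => by ring

theorem ofBlocks_sub (D D' : Fin p → Matrix (Fin m) (Fin n) ℂ) :
    ofBlocks (D - D') = ofBlocks D - ofBlocks D' := by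
  ext k i j
  simp only [ofBlocks_apply, Pi.sub_apply, Matrix.sub_apply, mul_sub, Finset.sum_sub_distrib]

theorem ofBlocks_sum {ι : Type*} (t : Finset ι) (D : ι → Fin p → Matrix (Fin m) (Fin n) ℂ) :
    ofBlocks (∑ x ∈ t, D x) = ∑ x ∈ t, ofBlocks (D x) := by
  ext k i j
  simp only [ofBlocks_apply, Finset.sum_apply, Matrix.sum_apply, Finset.mul_sum]
  exact Finset.sum_comm

/-- The four Penrose equations pass from the blocks to the block circulant matrix, and the
Moore-Penrose inverse is unique. -/
theorem tpinv_ofBlocks {D : Fin p → Matrix (Fin m) (Fin n) ℂ}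
    {X : Fin p → Matrix (Fin n) (Fin m) ℂ} (h : ∀ i, IsMoorePenrose (D i) (X i)) :
    (ofBlocks D).tpinv = ofBlocks X := by
  have hX : IsMoorePenrose (fourierConj D) (fourierConj X) := by
    constructor
    · simp only [fourierConj_mul, (h _).mul_mul_self]
    · simp only [fourierConj_mul, (h _).self_mul_mul]
    · simp only [fourierConj_mul, fourierConj_conjTranspose, (h _).left_herm]
    · simp only [fourierConj_mul, fourierConj_conjTranspose, (h _).right_herm]
  rw [tpinv, bcirc_ofBlocks, (pinv_spec _).unique hX, ofBlocks]

/-- The tensor whose only non-zero Fourier block, in position `i`, is the outer product of the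
`j`-th columns of `X i` and `Y i`. -/
noncomputable def rankOne {r : ℕ} (X : Fin p → Matrix (Fin m) (Fin r) ℂ)
    (Y : Fin p → Matrix (Fin n) (Fin r) ℂ) (i : Fin p) (j : Fin r) : Tensor3 m n p :=
  ofBlocks (Pi.single i (Matrix.vecMulVec (fun a => X i a j) (fun b => star (Y i b j))))

/-- This makes linearity in `d` explicit, so sums, scalars and entrywise integrals act on the
diagonal coefficients. -/
theorem ofBlocks_mul_diagonal_mul {r : ℕ} (X : Fin p → Matrix (Fin m) (Fin r) ℂ)
    (Y : Fin p → Matrix (Fin n) (Fin r) ℂ) (d : Fin p → Fin r → ℂ) :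
    ofBlocks (fun i => X i * Matrix.diagonal (d i) * (Y i)ᴴ)
      = ∑ ij : Fin p × Fin r, d ij.1 ij.2 • rankOne X Y ij.1 ij.2 := by
  simp only [rankOne, ← ofBlocks_smul, ← ofBlocks_sum]
  congr 1
  funext i
  ext a b
  rw [Finset.sum_apply, Matrix.sum_apply, Fintype.sum_prod_type, Finset.sum_eq_single i]
  · simp only [Matrix.mul_apply (N := (Y i)ᴴ), Matrix.mul_diagonal, Matrix.conjTranspose_apply,
      Pi.smul_apply, Matrix.smul_apply, Pi.single_eq_same, Matrix.vecMulVec_apply, smul_eq_mul]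
    exact Finset.sum_congr rfl fun j _ => by ring
  · intro x _ hx
    simp [Pi.single_eq_of_ne (Ne.symm hx)]
  · simp

end Tensor3

/-! ### Matrices with orthonormal factors -/

section Orthonormal

variable {ι κ l l' : Type*} [Fintype l] [DecidableEq l] [Fintype l'] [DecidableEq l']

theorem mul_diagonal_mul_mul_diagonal_mul [Fintype κ] {μ : Type*} {X : Matrix ι l ℂ} {Y : Matrix κ l ℂ}
    {Z : Matrix μ l ℂ} (hY : Yᴴ * Y = 1) (d e : l → ℂ) :
    X * Matrix.diagonal d * Yᴴ * (Y * Matrix.diagonal e * Zᴴ)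
      = X * Matrix.diagonal (fun j => d j * e j) * Zᴴ := by
  calc X * Matrix.diagonal d * Yᴴ * (Y * Matrix.diagonal e * Zᴴ)
      = X * Matrix.diagonal d * (Yᴴ * Y) * Matrix.diagonal e * Zᴴ := by
        simp only [Matrix.mul_assoc]
    _ = _ := by rw [hY, Matrix.mul_one, Matrix.mul_assoc X, Matrix.diagonal_mul_diagonal]

theorem conjTranspose_mul_diagonal_mul (X : Matrix ι l ℂ) (Y : Matrix κ l ℂ) (d : l → ℂ) :
    (X * Matrix.diagonal d * Yᴴ)ᴴ = Y * Matrix.diagonal (star d) * Xᴴ := by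
  rw [Matrix.conjTranspose_mul, Matrix.conjTranspose_mul, Matrix.conjTranspose_conjTranspose,
    Matrix.diagonal_conjTranspose, Matrix.mul_assoc]

/-- The convention `0⁻¹ = 0` is exactly the pseudo-inverse of a scalar, so vanishing diagonal
entries are covered. -/
theorem isMoorePenrose_mul_diagonal_mul [Fintype ι] [Fintype κ] {X : Matrix ι l ℂ} {Y : Matrix κ l ℂ} (hX : Xᴴ * X = 1)
    (hY : Yᴴ * Y = 1) (d : l → ℂ) :
    IsMoorePenrose (X * Matrix.diagonal d * Yᴴ) (Y * Matrix.diagonal (fun j => (d j)⁻¹) * Xᴴ) := by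
  constructor
  · rw [mul_diagonal_mul_mul_diagonal_mul hY, mul_diagonal_mul_mul_diagonal_mul hX]
    congr 3; funext j
    by_cases h : d j = 0 <;> simp [h]
  · rw [mul_diagonal_mul_mul_diagonal_mul hX, mul_diagonal_mul_mul_diagonal_mul hY]
    congr 3; funext j
    by_cases h : d j = 0 <;> simp [h]
  · rw [mul_diagonal_mul_mul_diagonal_mul hY, conjTranspose_mul_diagonal_mul]
    congr 3; funext j
    by_cases h : d j = 0 <;> simp [h]
  · rw [mul_diagonal_mul_mul_diagonal_mul hX, conjTranspose_mul_diagonal_mul]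
    congr 3; funext j
    by_cases h : d j = 0 <;> simp [h]

/-- The right factor `X` is needed: the constant term of `q` contributes a multiple of the identity,
whereas `X * Xᴴ` is only a projection. -/
theorem aeval_mul_diagonal_mul_mul [Fintype ι] [DecidableEq ι] {X : Matrix ι l ℂ} (hX : Xᴴ * X = 1) (d : l → ℂ)
    (q : Polynomial ℂ) :
    Polynomial.aeval (X * Matrix.diagonal d * Xᴴ) q * X
      = X * Matrix.diagonal fun j => q.eval (d j) := by
  have hM : X * Matrix.diagonal d * Xᴴ * X = X * Matrix.diagonal d := by
    rw [Matrix.mul_assoc, hX, Matrix.mul_one]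
  induction q using Polynomial.induction_on' with
  | add q₁ q₂ h₁ h₂ =>
    rw [map_add, Matrix.add_mul, h₁, h₂, ← Matrix.mul_add, Matrix.diagonal_add]
    simp only [Polynomial.eval_add]
  | monomial k a =>
    have hk : (X * Matrix.diagonal d * Xᴴ) ^ k * X = X * Matrix.diagonal fun j => d j ^ k := by
      induction k with
      | zero => simp
      | succ k ih =>
        rw [pow_succ, Matrix.mul_assoc, hM, ← Matrix.mul_assoc, ih, Matrix.mul_assoc,
          Matrix.diagonal_mul_diagonal]
        simp only [pow_succ]
    rw [Polynomial.aeval_monomial, Matrix.mul_assoc, hk, Algebra.algebraMap_eq_smul_one,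
      Matrix.smul_mul, Matrix.one_mul, ← Matrix.mul_smul,
      ← Matrix.diagonal_smul]
    congr 2
    funext j
    simp

theorem aeval_mul_conjTranspose_mul [Fintype ι] [Fintype κ] [DecidableEq ι] {X : Matrix ι l ℂ}
    {Y : Matrix κ l ℂ} (hX : Xᴴ * X = 1) (hY : Yᴴ * Y = 1) {σ : l → ℝ} {g : l → ℂ}
    {q : Polynomial ℂ} (hq : ∀ j, q.eval ((σ j : ℂ) * σ j) * σ j = g j) :
    Polynomial.aeval (X * Matrix.diagonal (fun j => (σ j : ℂ)) * Yᴴ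
        * (X * Matrix.diagonal (fun j => (σ j : ℂ)) * Yᴴ)ᴴ) q
        * (X * Matrix.diagonal (fun j => (σ j : ℂ)) * Yᴴ)
      = X * Matrix.diagonal g * Yᴴ := by
  rw [conjTranspose_mul_diagonal_mul, mul_diagonal_mul_mul_diagonal_mul hY, ← Matrix.mul_assoc,
    ← Matrix.mul_assoc, aeval_mul_diagonal_mul_mul hX, Matrix.mul_assoc X,
    Matrix.diagonal_mul_diagonal]
  congr 3
  funext j
  rw [← hq j]
  simp

/-- Functions of the singular values do not depend on the singular value decomposition. -/
theorem mul_diagonal_mul_congr [Fintype ι] [Fintype κ] {X : Matrix ι l ℂ} {Y : Matrix κ l ℂ} {X' : Matrix ι l' ℂ}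
    {Y' : Matrix κ l' ℂ} (hX : Xᴴ * X = 1) (hY : Yᴴ * Y = 1) (hX' : X'ᴴ * X' = 1)
    (hY' : Y'ᴴ * Y' = 1) {σ : l → ℝ} {σ' : l' → ℝ} (hσ : ∀ j, 0 ≤ σ j) (hσ' : ∀ j, 0 ≤ σ' j)
    (h : X * Matrix.diagonal (fun j => (σ j : ℂ)) * Yᴴ
      = X' * Matrix.diagonal (fun j => (σ' j : ℂ)) * Y'ᴴ) (f : ℂ → ℂ) :
    X * Matrix.diagonal (fun j => if σ j = 0 then 0 else f (σ j)) * Yᴴ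
      = X' * Matrix.diagonal (fun j => if σ' j = 0 then 0 else f (σ' j)) * Y'ᴴ := by
  classical
  let s : Finset ℂ := Finset.univ.image (fun j => ((σ j : ℂ) * σ j)) ∪
    Finset.univ.image (fun j => ((σ' j : ℂ) * σ' j))
  -- The nodes are the squared singular values of both decompositions, so one `q` serves for both.
  -- Its value at `0` is immaterial because it gets multiplied by a zero singular value.
  let q : Polynomial ℂ := Lagrange.interpolate s id
    fun x => f (Real.sqrt x.re : ℝ) / (Real.sqrt x.re : ℝ)
  have hq : ∀ x : ℝ, 0 ≤ x → (x : ℂ) * x ∈ s →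
      q.eval ((x : ℂ) * x) * x = if x = 0 then 0 else f x := by
    intro x hx hxs
    have h1 : q.eval ((x : ℂ) * x) = _ :=
      Lagrange.eval_interpolate_at_node (v := id) _ Function.injective_id.injOn hxs
    rw [h1, ← Complex.ofReal_mul, Complex.ofReal_re, Real.sqrt_mul_self hx]
    split_ifs with h0
    · simp [h0]
    · exact div_mul_cancel₀ _ (Complex.ofReal_ne_zero.2 h0)
  have key := aeval_mul_conjTranspose_mul hX hY fun j => hq (σ j) (hσ j) (by simp [s])
  have key' := aeval_mul_conjTranspose_mul hX' hY' fun j => hq (σ' j) (hσ' j) (by simp [s])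
  rw [← key, ← key', h]

end Orthonormal

/-! ### The compact T-SVD in terms of Fourier blocks -/

theorem rectDiag_eq {m n r : ℕ} (hr : r ≤ min m n) {d : Fin (min m n) → ℂ}
    (hd : ∀ j : Fin (min m n), r ≤ (j : ℕ) → d j = 0) :
    rectDiag d = (1 : Matrix (Fin m) (Fin m) ℂ).submatrix id (Fin.castLE (hr.trans (min_le_left m n)))
      * Matrix.diagonal (fun j => d (Fin.castLE hr j))
      * ((1 : Matrix (Fin n) (Fin n) ℂ).submatrix id
          (Fin.castLE (hr.trans (min_le_right m n))))ᴴ := by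
  ext a b
  rw [Matrix.mul_apply]
  simp only [rectDiag, Matrix.of_apply, Matrix.mul_diagonal,
    Matrix.conjTranspose_apply, Matrix.submatrix_apply, id, Matrix.one_apply, Fin.ext_iff,
    Fin.val_castLE]
  by_cases hab : (a : ℕ) = b
  · rw [dif_pos hab]
    by_cases har : (a : ℕ) < r
    · rw [Finset.sum_eq_single ⟨a, har⟩]
      · simp [← hab]
      · intro j _ hj
        rw [if_neg fun h : (a : ℕ) = j => hj (Fin.ext h.symm)]
        simp
      · simp
    · rw [hd _ (not_lt.1 har), Finset.sum_eq_zero]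
      intro j _
      rw [if_neg fun h : (a : ℕ) = j => har (h ▸ j.isLt)]
      simp
  · rw [dif_neg hab, Finset.sum_eq_zero]
    intro j _
    by_cases h : (a : ℕ) = j
    · rw [if_neg fun h' : (b : ℕ) = j => hab (h.trans h'.symm)]
      simp
    · simp [h]

theorem mul_rectDiag_mul {m n r : ℕ} (hr : r ≤ min m n) {d : Fin (min m n) → ℂ}
    (hd : ∀ j : Fin (min m n), r ≤ (j : ℕ) → d j = 0) (U : Matrix (Fin m) (Fin m) ℂ)
    (V : Matrix (Fin n) (Fin n) ℂ) :
    U * rectDiag d * Vᴴ = U.submatrix id (Fin.castLE (hr.trans (min_le_left m n)))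
      * Matrix.diagonal (fun j => d (Fin.castLE hr j))
      * (V.submatrix id (Fin.castLE (hr.trans (min_le_right m n))))ᴴ := by
  have h : ∀ {k l : ℕ} (M : Matrix (Fin k) (Fin k) ℂ) (e : Fin l → Fin k),
      M.submatrix id e = M * (1 : Matrix (Fin k) (Fin k) ℂ).submatrix id e := fun M e =>
    (Matrix.mul_submatrix_one (Equiv.refl _) e M).symm
  rw [rectDiag_eq hr hd, h U, h V, Matrix.conjTranspose_mul]
  simp only [Matrix.mul_assoc]

theorem submatrix_conjTranspose_mul_self {ι κ : Type*} [Fintype ι] [DecidableEq ι] [DecidableEq κ]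
    {U : Matrix ι ι ℂ} (hU : Uᴴ * U = 1) {e : κ → ι} (he : Function.Injective e) :
    (U.submatrix id e)ᴴ * U.submatrix id e = 1 := by
  rw [Matrix.conjTranspose_submatrix, ← Matrix.submatrix_mul _ _ e id e Function.bijective_id, hU,
    Matrix.submatrix_one e he]

/-- The leading square block is `diagonal d`, whose rank counts the non-zero entries; the indices up
to `j` already supply `j + 1` of them. -/
theorem lt_rank_rectDiag {m n : ℕ} {d : Fin (min m n) → ℂ} {j : Fin (min m n)}
    (hd : ∀ k ≤ j, d k ≠ 0) : (j : ℕ) < (rectDiag (m := m) (n := n) d).rank := by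
  classical
  have h1 : (rectDiag (m := m) (n := n) d).submatrix (Fin.castLE (min_le_left m n))
      (Fin.castLE (min_le_right m n)) = Matrix.diagonal d := by
    ext a b
    by_cases h : a = b
    · subst h; simp [rectDiag]
    · simp [rectDiag, h, Fin.val_ne_iff.2 h]
  have h2 := Matrix.rank_submatrix_le (rectDiag (m := m) (n := n) d)
    (Fin.castLE (min_le_left m n)) (Fin.castLE (min_le_right m n))
  rw [h1, Matrix.rank_diagonal, Fintype.card_subtype] at h2
  refine lt_of_lt_of_le ?_ h2
  calc (j : ℕ) < (Finset.Iic j).card := by simp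
    _ ≤ _ := Finset.card_le_card fun k hk => by simpa using hd k (Finset.mem_Iic.1 hk)

/-! ### Diagonal calculus on the compact T-SVD. -/

namespace TSVD

open Tensor3

variable {m n p : ℕ} [NeZero p] {A : Tensor3 m n p} (T : TSVD A)

theorem U_eq : T.U = ofBlocks T.Ublk := eq_ofBlocks T.bcirc_U

theorem S_eq : T.S = ofBlocks fun i => rectDiag fun j => (T.sv i j : ℂ) := eq_ofBlocks T.bcirc_S

theorem V_ctr_eq : T.V.ctr = ofBlocks fun i => (T.Vblk i)ᴴ := eq_ofBlocks T.bcirc_V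

theorem Ublk_conjTranspose_mul_self (i : Fin p) : (T.Ublk i)ᴴ * T.Ublk i = 1 := by
  have h := congrArg bcirc T.unitary_U.1
  rw [bcirc_tprod, bcirc_ctr, bcirc_ident, T.bcirc_U, fourierConj_conjTranspose, fourierConj_mul,
    ← fourierConj_one] at h
  exact congrFun (fourierConj_injective h) i

theorem Vblk_conjTranspose_mul_self (i : Fin p) : (T.Vblk i)ᴴ * T.Vblk i = 1 := by
  have h := congrArg bcirc T.unitary_V.1
  have hV : T.V.bcirc = fourierConj T.Vblk := by
    rw [← Matrix.conjTranspose_conjTranspose T.V.bcirc, ← bcirc_ctr, T.bcirc_V,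
      fourierConj_conjTranspose]
    simp only [Matrix.conjTranspose_conjTranspose]
  rw [bcirc_tprod, T.bcirc_V, hV, bcirc_ident, fourierConj_mul, ← fourierConj_one] at h
  exact congrFun (fourierConj_injective h) i

theorem Ublkr_conjTranspose_mul_self (i : Fin p) : (T.Ublkr i)ᴴ * T.Ublkr i = 1 :=
  submatrix_conjTranspose_mul_self (T.Ublk_conjTranspose_mul_self i) (Fin.castLE_injective _)

theorem Vblkr_conjTranspose_mul_self (i : Fin p) : (T.Vblkr i)ᴴ * T.Vblkr i = 1 :=
  submatrix_conjTranspose_mul_self (T.Vblk_conjTranspose_mul_self i) (Fin.castLE_injective _)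

/-- Since the singular values decrease, a non-zero one at `j` forces all earlier ones to be
non-zero, and then the block has rank above `j`. -/
theorem sv_eq_zero {i : Fin p} {j : Fin (min m n)} (hj : T.tubalRank ≤ j) : T.sv i j = 0 := by
  by_contra hne
  have hpos : 0 < T.sv i j := (T.sv_nonneg i j).lt_of_ne' hne
  have h1 := lt_rank_rectDiag (d := fun j => (T.sv i j : ℂ)) (j := j) fun k hk =>
    Complex.ofReal_ne_zero.2 (hpos.trans_le (T.sv_antitone i hk)).ne'
  have h2 : _ ≤ T.tubalRank := Finset.le_sup
    (f := fun i : Fin p => (rectDiag (m := m) (n := n) fun j => (T.sv i j : ℂ)).rank)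
    (Finset.mem_univ i)
  exact absurd (h1.trans_le h2) (not_lt.2 hj)

theorem c_nonneg (i : Fin p) (j : Fin T.tubalRank) : 0 ≤ T.c i j := T.sv_nonneg i _

/-- The tensor with Fourier blocks `(U_i)_r diag(d_i) (V_i)_rᴴ`. -/
noncomputable def compact (d : Fin p → Fin T.tubalRank → ℂ) : Tensor3 m n p :=
  ofBlocks fun i => T.Ublkr i * Matrix.diagonal (d i) * (T.Vblkr i)ᴴ

/-- The tensor with Fourier blocks `(V_i)_r diag(d_i) (U_i)_rᴴ`. -/
noncomputable def cocompact (d : Fin p → Fin T.tubalRank → ℂ) : Tensor3 n m p :=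
  ofBlocks fun i => T.Vblkr i * Matrix.diagonal (d i) * (T.Ublkr i)ᴴ

theorem ofBlocks_rectDiag_eq {d : Fin p → Fin (min m n) → ℂ}
    (hd : ∀ i (j : Fin (min m n)), T.tubalRank ≤ (j : ℕ) → d i j = 0) :
    T.U ∗ₜ ofBlocks (fun i => rectDiag (d i)) ∗ₜ T.V.ctr
      = T.compact fun i j => d i (Fin.castLE T.tubalRank_le j) := by
  rw [U_eq, V_ctr_eq, ofBlocks_tprod, ofBlocks_tprod, compact]
  congr 1
  funext i
  exact mul_rectDiag_mul T.tubalRank_le (hd i) _ _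

theorem eq_compact : A = T.compact fun i j => (T.c i j : ℂ) := by
  refine T.eq_prod.trans ?_
  rw [S_eq, T.ofBlocks_rectDiag_eq]
  · rfl
  · exact fun i j hj => by simp [T.sv_eq_zero hj]

theorem tensorFun_eq (f : ℂ → ℂ) :
    T.tensorFun f = T.compact fun i j => if T.c i j = 0 then 0 else f (T.c i j) :=
  T.ofBlocks_rectDiag_eq (d := fun i j => if T.sv i j = 0 then 0 else f (T.sv i j))
    fun i j hj => by simp [T.sv_eq_zero hj]

/-- Both T-SVDs have the same Fourier blocks of `A`, so the matrix statement applies block by block,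
even before the two tubal ranks are known to agree. -/
theorem tensorFun_congr (T' : TSVD A) (f : ℂ → ℂ) : T'.tensorFun f = T.tensorFun f := by
  have h := ofBlocks_injective (T'.eq_compact.symm.trans T.eq_compact)
  rw [tensorFun_eq, tensorFun_eq, compact, compact]
  congr 1
  funext i
  exact mul_diagonal_mul_congr (T'.Ublkr_conjTranspose_mul_self i)
    (T'.Vblkr_conjTranspose_mul_self i) (T.Ublkr_conjTranspose_mul_self i)
    (T.Vblkr_conjTranspose_mul_self i) (T'.c_nonneg i) (T.c_nonneg i) (congrFun h i) f

theorem E_eq : T.E = T.compact fun _ _ => 1 := by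
  rw [E, compact]
  change ofBlocks T.Ublkr ∗ₜ ofBlocks (fun i => (T.Vblkr i)ᴴ) = _
  rw [ofBlocks_tprod]
  simp

theorem compact_smul_sub (z : ℂ) (d e : Fin p → Fin T.tubalRank → ℂ) :
    z • T.compact d - T.compact e = T.compact fun i j => z * d i j - e i j := by
  rw [compact, compact, compact, ← ofBlocks_smul, ← ofBlocks_sub]
  congr 1
  funext i
  simp only [Pi.sub_apply, Pi.smul_apply]
  rw [← Matrix.smul_mul, ← Matrix.mul_smul, ← Matrix.sub_mul, ← Matrix.mul_sub,
    ← Matrix.diagonal_smul, Matrix.diagonal_sub]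
  rfl

theorem tpinv_compact (d : Fin p → Fin T.tubalRank → ℂ) :
    (T.compact d).tpinv = T.cocompact fun i j => (d i j)⁻¹ :=
  tpinv_ofBlocks fun i => isMoorePenrose_mul_diagonal_mul (T.Ublkr_conjTranspose_mul_self i)
    (T.Vblkr_conjTranspose_mul_self i) (d i)

theorem resolvent_eq (z : ℂ) : T.resolvent z = T.cocompact fun i j => (z - T.c i j)⁻¹ := by
  have h : T.resolvent z = (z • T.compact (fun _ _ => 1)
      - T.compact fun i j => (T.c i j : ℂ)).tpinv := by
    rw [← T.eq_compact, ← E_eq, resolvent]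
  rw [h, compact_smul_sub, tpinv_compact]
  simp only [mul_one]

theorem E_tprod_cocompact_tprod_E (d : Fin p → Fin T.tubalRank → ℂ) :
    T.E ∗ₜ T.cocompact d ∗ₜ T.E = T.compact d := by
  rw [E_eq, compact, cocompact, ofBlocks_tprod, ofBlocks_tprod, compact]
  congr 1
  funext i
  rw [mul_diagonal_mul_mul_diagonal_mul (T.Vblkr_conjTranspose_mul_self i),
    mul_diagonal_mul_mul_diagonal_mul (T.Ublkr_conjTranspose_mul_self i)]
  simp

theorem smul_cocompact (z : ℂ) (d : Fin p → Fin T.tubalRank → ℂ) :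
    z • T.cocompact d = T.cocompact fun i j => z * d i j := by
  rw [cocompact, cocompact, ofBlocks_mul_diagonal_mul, ofBlocks_mul_diagonal_mul, Finset.smul_sum]
  simp only [smul_smul]

theorem sum_cocompact {ι : Type*} (s : Finset ι) (d : ι → Fin p → Fin T.tubalRank → ℂ) :
    ∑ x ∈ s, T.cocompact (d x) = T.cocompact fun i j => ∑ x ∈ s, d x i j := by
  simp only [cocompact, ofBlocks_mul_diagonal_mul, Finset.sum_smul]
  exact Finset.sum_comm

theorem Ebar_eq (g : ℝ) : T.Ebar g = T.compact fun i j => if T.c i j = g then 1 else 0 := by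
  rw [compact, ofBlocks_mul_diagonal_mul, Ebar, Finset.sum_filter]
  refine Finset.sum_congr rfl fun ij _ => ?_
  split_ifs
  · rw [one_smul]; rfl
  · rw [zero_smul]

theorem c_mem_gammas (i : Fin p) (j : Fin T.tubalRank) : T.c i j ∈ T.gammas :=
  Finset.mem_image_of_mem (fun ij : Fin p × Fin T.tubalRank => T.c ij.1 ij.2)
    (Finset.mem_univ (i, j))

/-! ### Contour integrals of the resolvent. -/

/-- Every entry of the resolvent is a finite combination of simple fractions `1 / (z - c)`. -/
theorem tensorIntegral_resolvent (Γ : Contour) {f : ℂ → ℂ}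
    (hf : ContinuousOn f (Set.range Γ.path)) (hc : ∀ i j, (T.c i j : ℂ) ∉ Set.range Γ.path) :
    (Γ.tensorIntegral fun z => f z • T.resolvent z)
      = T.cocompact fun i j => Γ.cauchyTransform f (T.c i j) := by
  ext k a b
  simp only [Contour.tensorIntegral, Matrix.of_apply, resolvent_eq, smul_cocompact]
  simp only [cocompact, ofBlocks_mul_diagonal_mul, Finset.sum_apply, Pi.smul_apply,
    Matrix.sum_apply, Matrix.smul_apply, smul_eq_mul]
  exact Γ.contourIntegral_sum_mul (ι := Fin p × Fin T.tubalRank) Finset.univ hf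
    (fun ij => rankOne T.Vblkr T.Ublkr ij.1 ij.2 k a b) (fun ij => (T.c ij.1 ij.2 : ℂ))
    fun ij _ => hc ij.1 ij.2

/-- The contour integral around one spectral value picks out the terms with that value. -/
theorem smul_tensorIntegral_resolvent
    (Γ : T.gammas → Contour) (hin : ∀ g : T.gammas, ((g : ℝ) : ℂ) ∈ (Γ g).inside)
    (hout : ∀ g h : T.gammas, h ≠ g → ((h : ℝ) : ℂ) ∉ (Γ g).onOrInside)
    (g : T.gammas) {f : ℂ → ℂ}
    (hf : AnalyticOnNhd ℂ f (Γ g).onOrInside) :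
    (2 * Real.pi * Complex.I : ℂ)⁻¹ • ((Γ g).tensorIntegral fun z => f z • T.resolvent z)
      = T.cocompact fun i j => if T.c i j = g then f (T.c i j) else 0 := by
  rw [T.tensorIntegral_resolvent, smul_cocompact]
  · congr 1
    funext i j
    split_ifs with h
    · rw [h, (Γ g).cauchyTransform_of_mem_inside hf (hin g),
        inv_mul_cancel_left₀ Complex.two_pi_I_ne_zero]
    · rw [(Γ g).cauchyTransform_of_notMem hf
        (hout g ⟨_, T.c_mem_gammas i j⟩ fun h' => h (congrArg Subtype.val h')), mul_zero]
  · exact fun w hw =>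
      (hf w ((Γ g).range_subset_onOrInside hw)).continuousAt.continuousWithinAt
  · intro i j hij
    by_cases h : T.c i j = g
    · rw [h] at hij; exact (hin g).1 hij
    · exact hout g ⟨_, T.c_mem_gammas i j⟩ (fun h' => h (congrArg Subtype.val h'))
        ((Γ g).range_subset_onOrInside hij)

theorem smul_sum_tensorIntegral_resolvent
    (Γ : T.gammas → Contour) (hin : ∀ g : T.gammas, ((g : ℝ) : ℂ) ∈ (Γ g).inside)
    (hout : ∀ g h : T.gammas, h ≠ g → ((h : ℝ) : ℂ) ∉ (Γ g).onOrInside)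
    {f : ℂ → ℂ}
    (hf : ∀ g : T.gammas, AnalyticOnNhd ℂ f (Γ g).onOrInside) :
    (2 * Real.pi * Complex.I : ℂ)⁻¹ •
        ∑ g : T.gammas, ((Γ g).tensorIntegral fun z => f z • T.resolvent z)
      = T.cocompact fun i j => f (T.c i j) := by
  rw [Finset.smul_sum, Finset.sum_congr rfl fun g _ =>
    T.smul_tensorIntegral_resolvent Γ hin hout g (hf g), sum_cocompact]
  congr 1
  funext i j
  -- Each `c` is enclosed by exactly one contour, the one belonging to its own value.
  rw [Finset.sum_eq_single ⟨_, T.c_mem_gammas i j⟩]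
  · simp
  · exact fun g _ hg => if_neg fun h => hg (Subtype.ext h.symm)
  · simp

end TSVD

theorem mainTheorem2 {m n p : ℕ} [NeZero p] (A : Tensor3 m n p) (T : TSVD A)
    (Γ : T.gammas → Contour)
    (hin : ∀ g : T.gammas, ((g : ℝ) : ℂ) ∈ (Γ g).inside)
    (hout : ∀ g h : T.gammas, h ≠ g → ((h : ℝ) : ℂ) ∉ (Γ g).onOrInside) :
    (∀ g : T.gammas,
      T.Ebar g = T.E ∗ₜ ((2 * Real.pi * Complex.I : ℂ)⁻¹ •
        (Γ g).tensorIntegral fun z => T.resolvent z) ∗ₜ T.E) ∧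
    (∀ f : ℂ → ℂ,
      (∀ g : T.gammas, AnalyticOnNhd ℂ f (Γ g).onOrInside) →
      ((∃ i j, T.c i j = 0) → f 0 = 0) →
      ∀ T' : TSVD A,
        T'.tensorFun f = T.E ∗ₜ ((2 * Real.pi * Complex.I : ℂ)⁻¹ •
          ∑ g : T.gammas, (Γ g).tensorIntegral fun z => f z • T.resolvent z) ∗ₜ T.E) ∧
    ((∀ i j, T.c i j ≠ 0) →
      (∀ g : T.gammas, (0 : ℂ) ∉ (Γ g).onOrInside) →
      A.tpinv = (2 * Real.pi * Complex.I : ℂ)⁻¹ •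
        ∑ g : T.gammas, (Γ g).tensorIntegral fun z => z⁻¹ • T.resolvent z) := by
  refine ⟨fun g => ?_, fun f hf hf0 T' => ?_, fun hc h0 => ?_⟩
  · have h := T.smul_tensorIntegral_resolvent Γ hin hout g (f := fun _ => 1)
      fun _ _ => analyticAt_const
    simp only [one_smul] at h
    rw [h, T.E_tprod_cocompact_tprod_E, T.Ebar_eq]
  · rw [T.smul_sum_tensorIntegral_resolvent Γ hin hout hf, T.E_tprod_cocompact_tprod_E,
      T.tensorFun_congr T', T.tensorFun_eq]
    congr 1
    funext i j
    -- At a zero singular value `f^◇` keeps `0` while the integral yields `f 0`; the condition on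
    -- `f` reconciles them.
    split_ifs with h
    · rw [h, Complex.ofReal_zero, hf0 ⟨i, j, h⟩]
    · rfl
  -- For `f(z) = 1/z` the integral is already `cocompact` of the inverses of `c`, which is the
  -- pseudo-inverse itself, so no factors `E` appear.
  · rw [T.smul_sum_tensorIntegral_resolvent Γ hin hout (f := fun z => z⁻¹)
      fun g w hw => analyticAt_inv fun h => h0 g (h ▸ hw)]
    conv_lhs => rw [T.eq_compact]
    rw [T.tpinv_compact]
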